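/- Let $K\subset\mathbb R^3$ be a rectangular box with side lengths $a,b,c>0$. Let $d\ell=dA(q)\,dS(v)$ be the translation- and rotation-invariant measure on directed straight lines in $\mathbb R^3$. Here a directed line is described by its unit direction $v\in\mathbb S^2$ and by the point $q$ at which it meets the plane $v^\perp$ through the origin, $dS$ is surface measure on $\mathbb S^2$ and $dA$ is area measure on $v^\perp$. Choose a random directed line $\ell$ according to the restriction of $d\ell$ to the lines that intersect $K$, normalized to a probability measure, and let $X=\operatorname{length}(\ell\cap K)$. Then $X$ has a probability density function with respect to Lebesgue measure. It is given, for almost every $t$, by $$\operatorname{pdf}_X(t)=\frac{F(a,b,c,t)+F(b,c,a,t)+F(c,a,b,t)}{3\pi t^3(ab+ac+bc)}\qquad\text{for } 0<t<\sqrt{a^2+b^2+c^2},$$ and $\operatorname{pdf}_X(t)=0$ for all other $t$, where $F$ is defined piecewise as follows. For $0<t<a$, $$F(a,b,c,t)=t^3(8a-3t).$$ For $a<t<\sqrt{a^2+b^2}$, $$F(a,b,c,t)=6t^4-a^4+6\pi a^2bc-4(b+c)\sqrt{|t^2-a^2|}\,(a^2+2t^2).$$ For $\sqrt{a^2+b^2}<t<\sqrt{a^2+b^2+c^2}$,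 $$\begin{aligned}F(a,b,c,t)={}&6\pi a^2bc+b^4-3t^4-6a^2b^2+4c\sqrt{|t^2-a^2-b^2|}\,(a^2+b^2+2t^2)\\&+4a\sqrt{|t^2-b^2|}\,(b^2+2t^2)-12a^2bc\arctan\!\left(\frac{\sqrt{|t^2-a^2-b^2|}}{b}\right)\\&-4c\sqrt{|t^2-a^2|}\,(a^2+2t^2)-12ab^2c\arctan\!\left(\frac{\sqrt{|t^2-a^2-b^2|}}{a}\right).\end{aligned}$$ -/

import Mathlib

open MeasureTheory

noncomputable section

/-- Euclidean three-space. -/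
abbrev Space3 : Type := EuclideanSpace ℝ (Fin 3)

/-- The directed straight lines in three-space, as pairs `(v, q)` with `v` the unit direction
vector of the line and `q` the point of the line in the plane through the origin orthogonal
to `v`. The measurable structure is the Borel one inherited from `Space3 × Space3`. -/
abbrev DirectedLine : Type := {l : Space3 × Space3 // ‖l.1‖ = 1 ∧ inner ℝ l.1 l.2 = 0}

/-- The point of the directed line `(v, q)` at signed distance `s` from `q`, i.e. `q + s v`. -/
def DirectedLine.point (l : DirectedLine) (s : ℝ) : Space3 := l.1.2 + s • l.1.1

/-- The directed line with direction `v` on the unit sphere which meets the plane orthogonal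
to `v` at `q`. -/
def DirectedLine.mk (v : Metric.sphere (0 : Space3) 1)
    (q : ↥(Submodule.span ℝ {(v : Space3)})ᗮ) : DirectedLine :=
  ⟨((v : Space3), (q : Space3)), by
    refine ⟨by simp, ?_⟩
    exact Submodule.mem_orthogonal_singleton_iff_inner_right.mp q.2⟩

open Set in
/-- The plane measures depend measurably on the direction, so that they can be integrated over
the unit sphere. -/
theorem measurable_planeMeasure : Measurable fun v : Metric.sphere (0 : Space3) 1 =>
    (volume : Measure ↥(Submodule.span ℝ {(v : Space3)})ᗮ).map (DirectedLine.mk v) := by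
  have hc : ∀ v, Measurable (DirectedLine.mk v) := by
    intro v
    unfold DirectedLine.mk
    exact Measurable.subtype_mk (measurable_const.prodMk measurable_subtype_coe)
  refine Measure.measurable_of_measurable_coe _ fun A hA => ?_
  let φ : Metric.sphere (0 : Space3) 1 × Space3 → DirectedLine := fun z =>
    ⟨((z.1 : Space3), z.2 - (inner ℝ (z.1 : Space3) z.2 : ℝ) • (z.1 : Space3)), by
      have h1 : ‖(z.1 : Space3)‖ = 1 := by simp
      refine ⟨h1, ?_⟩
      simp [inner_sub_right, inner_smul_right, h1]⟩
  have hφ : Measurable φ := by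
    apply Measurable.subtype_mk
    fun_prop
  let B : Set (Metric.sphere (0 : Space3) 1 × Space3) :=
    φ ⁻¹' A ∩ {z | (inner ℝ (z.1 : Space3) z.2 : ℝ) ∈ Ico (0:ℝ) 1}
  have hB : MeasurableSet B := by
    refine (hφ hA).inter ?_
    have : Measurable fun z : Metric.sphere (0 : Space3) 1 × Space3 => (inner ℝ (z.1 : Space3) z.2 : ℝ) := by fun_prop
    exact this measurableSet_Ico
  have key : ∀ v : Metric.sphere (0 : Space3) 1,
      (volume : Measure ↥(Submodule.span ℝ {(v : Space3)})ᗮ).map (DirectedLine.mk v) A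
        = volume (Prod.mk v ⁻¹' B) := by
    intro v
    have h1 : ‖(v : Space3)‖ = 1 := by simp
    rw [Measure.map_apply (hc v) hA]
    set S := Submodule.span ℝ {(v : Space3)} with hS
    have hm : MeasurePreserving (fun q : S × Sᗮ => (q.1 : Space3) + q.2) := by
      have := (S.orthogonalDecomposition.symm.measurePreserving).comp
        (WithLp.volume_preserving_toLp S Sᗮ)
      convert this using 1
      ext1 q
      simp
    have hU := (LinearIsometryEquiv.toSpanUnitSingleton (𝕜 := ℝ) (v : Space3) h1).measurePreserving
    rw [← hm.measure_preimage (hB.preimage measurable_prodMk_left).nullMeasurableSet]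
    have : (fun q : S × Sᗮ => (q.1 : Space3) + q.2) ⁻¹' (Prod.mk v ⁻¹' B)
        = {s : S | (inner ℝ (v : Space3) (s : Space3) : ℝ) ∈ Ico (0:ℝ) 1} ×ˢ (DirectedLine.mk v ⁻¹' A) := by
      ext ⟨⟨s, hs⟩, q⟩
      obtain ⟨r, rfl⟩ := Submodule.mem_span_singleton.1 hs
      have hq : inner ℝ (v : Space3) (q : Space3) = 0 :=
        Submodule.mem_orthogonal_singleton_iff_inner_right.mp q.2
      simp [B, φ, DirectedLine.mk, inner_add_right, inner_smul_right, hq, and_comm]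
    rw [this, Measure.volume_eq_prod, Measure.prod_prod]
    have : volume {s : S | (inner ℝ (v : Space3) (s : Space3) : ℝ) ∈ Ico (0:ℝ) 1} = 1 := by
      rw [← hU.measure_preimage_equiv (f := (LinearIsometryEquiv.toSpanUnitSingleton (𝕜 := ℝ) (v : Space3) h1).toMeasurableEquiv)]
      have : (LinearIsometryEquiv.toSpanUnitSingleton (𝕜 := ℝ) (v : Space3) h1).toMeasurableEquiv ⁻¹'
          {s : S | (inner ℝ (v : Space3) (s : Space3) : ℝ) ∈ Ico (0:ℝ) 1} = Ico 0 1 := by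
        ext r
        change (inner ℝ (v : Space3) (r • (v : Space3)) : ℝ) ∈ Ico (0:ℝ) 1 ↔ _
        simp [inner_smul_right]
      rw [this]; simp
    rw [this, one_mul]
  simp_rw [key]
  exact measurable_measure_prodMk_left hB

/-- The translation- and rotation-invariant measure `dA(q) dS(v)` on directed lines: `dS` is the
surface measure on the unit sphere, and `dA` the area measure on the plane orthogonal to `v`. -/
def lineMeasure : Measure DirectedLine :=
  ((volume : Measure Space3).toSphere).bind fun v =>
    (volume : Measure ↥(Submodule.span ℝ {(v : Space3)})ᗮ).map (DirectedLine.mk v)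

/-- The directed lines that intersect the set `K`. -/
def linesMeeting (K : Set Space3) : Set DirectedLine := {l | ∃ s : ℝ, l.point s ∈ K}

/-- The law of a random directed line intersecting `K`: the restriction of the invariant measure
to the lines that intersect `K`, normalized by its total mass. -/
def randomLine (K : Set Space3) : Measure DirectedLine :=
  ProbabilityTheory.cond lineMeasure (linesMeeting K)

/-- The length of the intersection of a directed line with `K` (lines are parametrized by
arc length). -/
def chordLength (K : Set Space3) (l : DirectedLine) : ℝ :=
  (volume {s : ℝ | l.point s ∈ K}).toReal

/-- The closed rectangular box with a vertex at `p`, edges in the directions of the orthonormal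
basis `e`, and side lengths `a`, `b`, `c`. -/
def box (e : OrthonormalBasis (Fin 3) ℝ Space3) (p : Space3) (a b c : ℝ) : Set Space3 :=
  {x | ∀ i, inner ℝ (e i) (x - p) ∈ Set.Icc 0 (![a, b, c] i)}

/-- The piecewise function `F(a, b, c, t)` in the density, for `t` in `(0, √(a² + b² + c²))`. Its
values at the two breakpoints `a` and `√(a² + b²)` are immaterial. -/
def boxF (a b c t : ℝ) : ℝ :=
  if t < a then t ^ 3 * (8 * a - 3 * t)
  else if t < √(a ^ 2 + b ^ 2) then
    (6 * t ^ 4 - a ^ 4 + 6 * Real.pi * a ^ 2 * b * c)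
      - 4 * (b + c) * √|t ^ 2 - a ^ 2| * (a ^ 2 + 2 * t ^ 2)
  else
    6 * Real.pi * a ^ 2 * b * c + b ^ 4 - 3 * t ^ 4 - 6 * a ^ 2 * b ^ 2
      + √|t ^ 2 - a ^ 2 - b ^ 2| * 4 * c * (a ^ 2 + b ^ 2 + 2 * t ^ 2)
      + 4 * a * √|t ^ 2 - b ^ 2| * (b ^ 2 + 2 * t ^ 2)
      - 12 * a ^ 2 * b * c * Real.arctan (√|t ^ 2 - a ^ 2 - b ^ 2| / b)
      - 4 * c * √|t ^ 2 - a ^ 2| * (a ^ 2 + 2 * t ^ 2)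
      - 12 * a * b ^ 2 * c * Real.arctan (√|t ^ 2 - a ^ 2 - b ^ 2| / a)

end

noncomputable section

/-! The density is the second derivative of the mean excess `H(t) = ∫ (X - t)⁺` with respect to the
invariant measure, divided by the mass of the lines that meet the box. Since `-H'(t)` is the mass of
`{X > t}`, it suffices to find `H` in closed form.

A chord is an interval, so `(X - t)⁺` is the length of its overlap with its own translate by `t`.
Fubini over the parallel lines of direction `v` turns the inner integral into the volume of `K ∩ (K
- t v)`, which for a box is the product of the `(kᵢ - t |vᵢ|)⁺`, where `kᵢ` are the side lengths
(`lintegral_chordLength_sub`). Hence `H(t)` is an integral of this product over the sphere.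

Write each factor as `x⁺ = x + (-x)⁺` and expand. The term with no positive part is an integral over
the whole sphere (`tau0`), a term with one positive part lives on the cap `t |vᵢ| > kᵢ` (`tau1`),
and a term with two on the intersection of two caps (`tau2`). The term with three vanishes up to the
diagonal, because `∑ vᵢ² = 1` (`integral_boxOverlap`). In spherical coordinates each integral has an
explicit primitive.

Every cap term and its first derivative vanish where the term sets in, so the closed form `excess`
is continuously differentiable and its second derivative exists off six breakpoints, where it equals
`2 ∑ F / (3 t³)` (`excess''_eq_boxF`). The bound `excess = O((D² - t²)²)` with `D` the diagonal
gives `excess'(D) = 0`, and `-excess'(0)` is the total mass (`lineMeasure_chordLength_pos`). Lines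
touching the box in a single point are null (`linesMeeting_ae_eq`), so the law of `X` and the
candidate density have the same tails, and hence agree. -/

/-! ### Parallel lines and the set covariance of a box -/

/-- Fubini's theorem for a set cut by the lines in a fixed direction. -/
theorem lintegral_volume_line (v : Metric.sphere (0 : Space3) 1) {B : Set Space3}
    (hB : MeasurableSet B) :
    ∫⁻ q : ↥(Submodule.span ℝ {(v : Space3)})ᗮ,
      volume {s : ℝ | (q : Space3) + s • (v : Space3) ∈ B} = volume B := by
  have h1 : ‖(v : Space3)‖ = 1 := by simp
  set S := Submodule.span ℝ {(v : Space3)} with hS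
  have hm : MeasurePreserving (fun q : S × Sᗮ => (q.1 : Space3) + q.2) := by
    have := (S.orthogonalDecomposition.symm.measurePreserving).comp
      (WithLp.volume_preserving_toLp S Sᗮ)
    convert this using 1
    ext1 q
    simp
  have hU := (LinearIsometryEquiv.toSpanUnitSingleton (𝕜 := ℝ) (v : Space3) h1).measurePreserving
  rw [← hm.measure_preimage hB.nullMeasurableSet, Measure.volume_eq_prod,
    Measure.prod_apply_symm (hm.measurable hB)]
  refine lintegral_congr fun q => ?_
  rw [← hU.measure_preimage (f := (LinearIsometryEquiv.toSpanUnitSingleton (𝕜 := ℝ) (v : Space3) h1))]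
  · congr 1
    ext s
    simp [LinearIsometryEquiv.toSpanUnitSingleton, add_comm]
  · exact (measurable_prodMk_right (hm.measurable hB)).nullMeasurableSet

theorem box_eq_preimage (e : OrthonormalBasis (Fin 3) ℝ Space3) (p : Space3) (a b c : ℝ) :
    box e p a b c = (fun x i => e.repr (x - p) i) ⁻¹' Set.Icc 0 ![a, b, c] := by
  ext x
  simp only [box, Set.mem_preimage, Set.mem_Icc, Pi.le_def, ← forall_and, Set.mem_ofPred_eq,
    OrthonormalBasis.repr_apply_apply]
  rfl

/-- The coordinates with respect to an orthonormal basis and an origin. -/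
def boxCoord (e : OrthonormalBasis (Fin 3) ℝ Space3) (p : Space3) : Space3 ≃ₜ (Fin 3 → ℝ) :=
  ((Homeomorph.subRight p).trans e.repr.toHomeomorph).trans (PiLp.homeomorph 2 fun _ => ℝ)

theorem boxCoord_apply (e : OrthonormalBasis (Fin 3) ℝ Space3) (p x : Space3) :
    boxCoord e p x = fun i => e.repr (x - p) i := rfl

theorem measurePreserving_boxCoord (e : OrthonormalBasis (Fin 3) ℝ Space3) (p : Space3) :
    MeasurePreserving (boxCoord e p) := by
  have h := ((EuclideanSpace.volume_preserving_symm_measurableEquiv_toLp (Fin 3)).comp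
    e.measurePreserving_repr).comp (measurePreserving_sub_right volume p)
  exact h

theorem isCompact_box (e : OrthonormalBasis (Fin 3) ℝ Space3) (p : Space3) (a b c : ℝ) :
    IsCompact (box e p a b c) := by
  rw [box_eq_preimage]
  exact (boxCoord e p).isCompact_preimage.2 isCompact_Icc

theorem volume_Icc_inter_shift (a w : ℝ) :
    volume {y : ℝ | y ∈ Set.Icc 0 a ∧ y + w ∈ Set.Icc 0 a} = ENNReal.ofReal (a - |w|) := by
  have : {y : ℝ | y ∈ Set.Icc 0 a ∧ y + w ∈ Set.Icc 0 a}
      = Set.Icc (max 0 (-w)) (min a (a - w)) := by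
    ext y
    simp only [Set.mem_Icc, Set.mem_ofPred_eq, max_le_iff, le_min_iff]
    constructor
    · rintro ⟨⟨h1, h2⟩, h3, h4⟩; refine ⟨⟨h1, ?_⟩, h2, ?_⟩ <;> linarith
    · rintro ⟨⟨h1, h2⟩, h3, h4⟩; refine ⟨⟨h1, h3⟩, ?_, ?_⟩ <;> linarith
  rw [this, Real.volume_Icc]
  congr 1
  rcases le_total 0 w with h | h
  · rw [abs_of_nonneg h, max_eq_left (by linarith), min_eq_right (by linarith)]; ring
  · rw [abs_of_nonpos h, max_eq_right (by linarith), min_eq_left (by linarith)]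

/-- In the coordinates of `e` the box and its translate are both products of intervals, so the
overlap factors. `ENNReal.ofReal` supplies the positive part when a factor is empty. -/
theorem volume_box_inter_shift (e : OrthonormalBasis (Fin 3) ℝ Space3) (p w : Space3)
    (a b c : ℝ) :
    volume {x | x ∈ box e p a b c ∧ x + w ∈ box e p a b c}
      = ∏ i, ENNReal.ofReal (![a, b, c] i - |inner ℝ (e i) w|) := by
  have : {x | x ∈ box e p a b c ∧ x + w ∈ box e p a b c} = boxCoord e p ⁻¹'
      (Set.univ.pi fun i => {y : ℝ | y ∈ Set.Icc 0 (![a, b, c] i) ∧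
        y + inner ℝ (e i) w ∈ Set.Icc 0 (![a, b, c] i)}) := by
    ext x
    simp only [box, boxCoord_apply, Set.mem_preimage, Set.mem_pi, Set.mem_univ, true_imp_iff,
      Set.mem_ofPred_eq, OrthonormalBasis.repr_apply_apply, ← forall_and, ← inner_add_right,
      sub_add_eq_add_sub]
  rw [this, (measurePreserving_boxCoord e p).measure_preimage, volume_pi, Measure.pi_pi]
  · simp_rw [volume_Icc_inter_shift]
  · refine (MeasurableSet.univ_pi fun i => ?_).nullMeasurableSet
    exact measurableSet_Icc.inter ((measurable_add_const _) measurableSet_Icc)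

theorem DirectedLine.isometry_point (l : DirectedLine) : Isometry l.point := by
  refine Isometry.of_dist_eq fun s t => ?_
  rw [DirectedLine.point, DirectedLine.point, dist_add_left, dist_eq_norm, ← sub_smul, norm_smul,
    l.2.1, mul_one, dist_eq_norm]

theorem isCompact_chord (e : OrthonormalBasis (Fin 3) ℝ Space3) (p : Space3) (a b c : ℝ)
    (l : DirectedLine) : IsCompact {s : ℝ | l.point s ∈ box e p a b c} :=
  l.isometry_point.isClosedEmbedding.isCompact_preimage (isCompact_box e p a b c)

theorem convex_chord (e : OrthonormalBasis (Fin 3) ℝ Space3) (p : Space3) (a b c : ℝ)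
    (l : DirectedLine) : Set.OrdConnected {s : ℝ | l.point s ∈ box e p a b c} := by
  refine ⟨fun x hx y hy z hz i => ?_⟩
  have hx := hx i
  have hy := hy i
  simp only [DirectedLine.point, add_sub_right_comm, inner_add_right, inner_smul_right,
    Set.mem_Icc] at hx hy ⊢
  obtain ⟨h1, h2⟩ := hz
  set w := inner ℝ (e i) l.1.1
  rcases le_total 0 w with h | h
  · constructor <;> nlinarith
  · constructor <;> nlinarith

/-- Here convexity of the box enters: only for an interval is the excess of its length over `t` the
length of its overlap with the translate by `t`. -/
theorem volume_inter_shift_of_ordConnected {I : Set ℝ} (hI : I.OrdConnected) (hc : IsCompact I)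
    {t : ℝ} (ht : 0 ≤ t) :
    volume {s | s ∈ I ∧ s + t ∈ I} = ENNReal.ofReal ((volume I).toReal - t) := by
  rcases I.eq_empty_or_nonempty with rfl | hne
  · simp [ht]
  · have h := eq_Icc_of_connected_compact ⟨hne, hI.isPreconnected⟩ hc
    generalize sInf I = α at h
    generalize sSup I = β at h
    subst h
    have hαβ := Set.nonempty_Icc.1 hne
    have : {s | s ∈ Set.Icc α β ∧ s + t ∈ Set.Icc α β} = Set.Icc α (β - t) := by
      ext s
      simp only [Set.mem_Icc, Set.mem_ofPred_eq]
      constructor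
      · rintro ⟨⟨h1, h2⟩, h3, h4⟩; exact ⟨h1, by linarith⟩
      · rintro ⟨h1, h2⟩; refine ⟨⟨h1, ?_⟩, ?_, ?_⟩ <;> linarith
    rw [this, Real.volume_Icc, Real.volume_Icc, ENNReal.toReal_ofReal (by linarith)]
    congr 1; ring

theorem measurable_chordLength {K : Set Space3} (hK : MeasurableSet K) :
    Measurable (chordLength K) := by
  unfold chordLength
  refine Measurable.ennreal_toReal ?_
  have : MeasurableSet {z : DirectedLine × ℝ | z.1.point z.2 ∈ K} := by
    refine Measurable.comp (g := id) measurable_id ?_ hK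
    fun_prop
  exact measurable_measure_prodMk_left this

theorem measurable_directedLine_mk (v : Metric.sphere (0 : Space3) 1) :
    Measurable (DirectedLine.mk v) := by
  unfold DirectedLine.mk
  exact Measurable.subtype_mk (measurable_const.prodMk measurable_subtype_coe)

theorem lintegral_lineMeasure {f : DirectedLine → ENNReal} (hf : Measurable f) :
    ∫⁻ l, f l ∂lineMeasure = ∫⁻ v : Metric.sphere (0 : Space3) 1,
      (∫⁻ q : ↥(Submodule.span ℝ {(v : Space3)})ᗮ, f (DirectedLine.mk v q))
        ∂(volume : Measure Space3).toSphere := by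
  rw [lineMeasure, Measure.lintegral_bind measurable_planeMeasure.aemeasurable hf.aemeasurable]
  refine lintegral_congr fun v => ?_
  rw [lintegral_map hf (measurable_directedLine_mk v)]

/-- A line of direction `v` cuts `K ∩ (K - t v)` in the overlap of its chord with the chord shifted
by `t`. Summing these lengths over all such lines gives the volume of `K ∩ (K - t v)`. -/
theorem lintegral_chordLength_sub_direction (e : OrthonormalBasis (Fin 3) ℝ Space3) (p : Space3)
    (a b c : ℝ) {t : ℝ} (ht : 0 ≤ t) (v : Metric.sphere (0 : Space3) 1) :
    ∫⁻ q : ↥(Submodule.span ℝ {(v : Space3)})ᗮ,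
        ENNReal.ofReal (chordLength (box e p a b c) (DirectedLine.mk v q) - t)
      = ∏ i, ENNReal.ofReal (![a, b, c] i - t * |inner ℝ (e i) (v : Space3)|) := by
  have hK := (isCompact_box e p a b c).measurableSet
  have hB : MeasurableSet {x | x ∈ box e p a b c ∧ x + t • (v : Space3) ∈ box e p a b c} :=
    MeasurableSet.inter (s₁ := box e p a b c) hK
      (hK.preimage (measurable_id.add_const (t • (v : Space3))))
  have h := volume_box_inter_shift e p (t • (v : Space3)) a b c
  rw [← lintegral_volume_line v hB] at h
  simp_rw [inner_smul_right, abs_mul, abs_of_nonneg ht] at h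
  rw [← h]
  refine lintegral_congr fun q => ?_
  rw [chordLength, ← volume_inter_shift_of_ordConnected (convex_chord e p a b c _)
    (isCompact_chord e p a b c _) ht]
  congr 1
  ext s
  simp [DirectedLine.point, DirectedLine.mk, add_smul, add_assoc]

/-- The mean excess of the chord length of a box over `t` is an integral of set covariances. -/
theorem lintegral_chordLength_sub (e : OrthonormalBasis (Fin 3) ℝ Space3) (p : Space3)
    (a b c : ℝ) {t : ℝ} (ht : 0 ≤ t) :
    ∫⁻ l, ENNReal.ofReal (chordLength (box e p a b c) l - t) ∂lineMeasure
      = ∫⁻ v : Metric.sphere (0 : Space3) 1,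
        (∏ i, ENNReal.ofReal (![a, b, c] i - t * |inner ℝ (e i) (v : Space3)|))
          ∂(volume : Measure Space3).toSphere := by
  have hm : Measurable fun l => ENNReal.ofReal (chordLength (box e p a b c) l - t) :=
    ((measurable_chordLength (isCompact_box e p a b c).measurableSet).sub_const t).ennreal_ofReal
  rw [lintegral_lineMeasure hm]
  exact lintegral_congr fun v => lintegral_chordLength_sub_direction e p a b c ht v

/-! ### Spherical coordinates on the unit sphere -/

open Set Real in
theorem lintegral_polar (g : ℝ × ℝ → ENNReal) (hg : Measurable g) :
    ∫⁻ p, g p = ∫⁻ θ in Ioo (-π) π, ∫⁻ r in Ioi (0 : ℝ),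
      ENNReal.ofReal r * g (r * cos θ, r * sin θ) := by
  rw [← lintegral_comp_polarCoord_symm, polarCoord_target, Measure.volume_eq_prod,
    ← Measure.prod_restrict, lintegral_prod_symm]
  · rfl
  · refine Measurable.aemeasurable ?_
    have : Measurable fun p : ℝ × ℝ => polarCoord.symm p :=
      continuous_polarCoord_symm.measurable
    simp only [smul_eq_mul]
    fun_prop

-- Polar coordinates are applied twice: to the last two coordinates, with radius `ρ` and azimuth
-- `φ`, and then to the first coordinate and `ρ`, with radius `r` and polar angle `ξ`. The second
-- use needs a function on the whole plane, so the integrand is extended by zero to `ρ ≤ 0`; this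
-- leaves only `ξ` in `(0, π)`.
open Set Real in
theorem lintegral_spherical (F : ℝ × ℝ × ℝ → ENNReal) (hF : Measurable F) :
    ∫⁻ p, F p = ∫⁻ φ in Ioo (-π) π, ∫⁻ ξ in Ioo 0 π, ∫⁻ r in Ioi (0 : ℝ),
      ENNReal.ofReal (r ^ 2 * sin ξ) *
        F (r * cos ξ, r * (sin ξ * cos φ), r * (sin ξ * sin φ)) := by
  rw [Measure.volume_eq_prod, lintegral_prod _ hF.aemeasurable]
  have h1 : ∀ x, ∫⁻ q, F (x, q) = ∫⁻ φ in Ioo (-π) π, ∫⁻ r in Ioi (0 : ℝ),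
      ENNReal.ofReal r * F (x, r * cos φ, r * sin φ) := fun x =>
    lintegral_polar (fun q => F (x, q)) (by fun_prop)
  simp_rw [h1]
  rw [lintegral_lintegral_swap]
  swap
  · refine Measurable.aemeasurable ?_
    refine Measurable.lintegral_prod_right'
      (f := fun z : (ℝ × ℝ) × ℝ => ENNReal.ofReal z.2 * F (z.1.1, z.2 * cos z.1.2, z.2 * sin z.1.2)) ?_
    fun_prop
  refine lintegral_congr fun φ => ?_
  have hmeas : Measurable fun p : ℝ × ℝ => (Ioi (0 : ℝ)).indicator
      (fun ρ => ENNReal.ofReal ρ * F (p.1, ρ * cos φ, ρ * sin φ)) p.2 := by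
    have : (fun p : ℝ × ℝ => (Ioi (0 : ℝ)).indicator
      (fun ρ => ENNReal.ofReal ρ * F (p.1, ρ * cos φ, ρ * sin φ)) p.2) =
      ((Prod.snd : ℝ × ℝ → ℝ) ⁻¹' Ioi (0 : ℝ)).indicator fun p =>
        ENNReal.ofReal p.2 * F (p.1, p.2 * cos φ, p.2 * sin φ) := rfl
    rw [this]
    exact Measurable.indicator (by fun_prop) (measurable_snd measurableSet_Ioi)
  have h2 : ∀ x, ∫⁻ r in Ioi (0 : ℝ), ENNReal.ofReal r * F (x, r * cos φ, r * sin φ)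
      = ∫⁻ ρ, (Ioi (0 : ℝ)).indicator
        (fun ρ => ENNReal.ofReal ρ * F (x, ρ * cos φ, ρ * sin φ)) ρ := fun x => by
    rw [lintegral_indicator measurableSet_Ioi]
  simp_rw [h2]
  rw [← lintegral_prod (fun p : ℝ × ℝ => (Ioi (0 : ℝ)).indicator
      (fun ρ => ENNReal.ofReal ρ * F (p.1, ρ * cos φ, ρ * sin φ)) p.2) hmeas.aemeasurable,
    ← Measure.volume_eq_prod, lintegral_polar _ hmeas]
  have hsub : Ioo (0 : ℝ) π ⊆ Ioo (-π) π := Ioo_subset_Ioo_left (by linarith [pi_pos])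
  rw [← lintegral_indicator measurableSet_Ioo, ← lintegral_indicator measurableSet_Ioo]
  refine lintegral_congr fun ξ => ?_
  by_cases hξ : ξ ∈ Ioo 0 π
  · rw [indicator_of_mem (hsub hξ), indicator_of_mem hξ]
    refine setLIntegral_congr_fun measurableSet_Ioi fun r hr => ?_
    have hs := sin_pos_of_mem_Ioo hξ
    have hr : 0 < r := hr
    have : r * sin ξ ∈ Ioi (0 : ℝ) := mul_pos hr hs
    simp only [indicator_of_mem this]
    rw [← mul_assoc, ← ENNReal.ofReal_mul hr.le]
    ring_nf
  · rw [indicator_of_notMem hξ]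
    by_cases h : ξ ∈ Ioo (-π) π
    · rw [indicator_of_mem h]
      have hs : sin ξ ≤ 0 := sin_nonpos_of_nonpos_of_neg_pi_le
        (not_lt.1 fun h0 => hξ ⟨h0, h.2⟩) h.1.le
      rw [setLIntegral_congr_fun (g := fun _ => 0) measurableSet_Ioi, lintegral_zero]
      intro r hr
      have hr : 0 < r := hr
      have : r * sin ξ ∉ Ioi (0 : ℝ) := not_lt.2 (mul_nonpos_of_nonneg_of_nonpos hr.le hs)
      simp only [indicator_of_notMem this, mul_zero]
    · rw [indicator_of_notMem h]

theorem lintegral_radial_sq :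
    ∫⁻ r in Set.Ioi (0 : ℝ), (if r < 1 then ENNReal.ofReal (r ^ 2) else 0)
      = ENNReal.ofReal (1 / 3) := by
  have : ∀ r : ℝ, (if r < 1 then ENNReal.ofReal (r ^ 2) else 0)
      = (Set.Iio 1).indicator (fun r => ENNReal.ofReal (r ^ 2)) r := fun r => by
    simp [Set.indicator_apply]
  simp_rw [this]
  rw [lintegral_indicator measurableSet_Iio, Measure.restrict_restrict measurableSet_Iio,
    Set.Iio_inter_Ioi, Measure.restrict_congr_set Ioo_ae_eq_Ioc,
    ← ofReal_integral_eq_lintegral_ofReal (intervalIntegral.intervalIntegrable_pow _).1 ,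
    ← intervalIntegral.integral_of_le zero_le_one]
  · norm_num
  · exact Filter.Eventually.of_forall fun r => by positivity

/-- Integration of a positively homogeneous extension over the unit ball. -/
theorem lintegral_ball_direction {E : Type*} [NormedAddCommGroup E] [InnerProductSpace ℝ E]
    [MeasurableSpace E] [BorelSpace E] [FiniteDimensional ℝ E]
    (hE : Module.finrank ℝ E = 3) (Φ : E → ENNReal) (hΦ : Measurable Φ) :
    ∫⁻ x : E, (if ‖x‖ < 1 then Φ (‖x‖⁻¹ • x) else 0)
      = (∫⁻ v : Metric.sphere (0 : E) 1, Φ v ∂(volume : Measure E).toSphere)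
        * ENNReal.ofReal (1 / 3) := by
  have : Nontrivial E := Module.nontrivial_of_finrank_pos (R := ℝ) (by omega)
  have h0 : ∫⁻ x : E, (if ‖x‖ < 1 then Φ (‖x‖⁻¹ • x) else 0)
      = ∫⁻ x in {(0 : E)}ᶜ, (if ‖x‖ < 1 then Φ (‖x‖⁻¹ • x) else 0) := by
    rw [restrict_compl_singleton]
  rw [h0, ← lintegral_subtype_comap (measurableSet_singleton (0 : E)).compl]
  have hmp := (volume : Measure E).measurePreserving_homeomorphUnitSphereProd
  rw [hE] at hmp
  have : ∀ x : ({0}ᶜ : Set E), (if ‖(x : E)‖ < 1 then Φ (‖(x : E)‖⁻¹ • (x : E)) else 0)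
      = (fun z : Metric.sphere (0 : E) 1 × Set.Ioi (0 : ℝ) =>
          Φ z.1 * (if z.2.1 < 1 then 1 else 0)) (homeomorphUnitSphereProd E x) := fun x => by
    simp
  simp_rw [this]
  rw [hmp.lintegral_comp (f := fun z : Metric.sphere (0 : E) 1 × Set.Ioi (0 : ℝ) =>
          Φ z.1 * (if z.2.1 < 1 then 1 else 0))]
  · rw [lintegral_prod_mul (f := fun v : Metric.sphere (0 : E) 1 => Φ v)
      (g := fun r : Set.Ioi (0 : ℝ) => if r.1 < 1 then (1 : ENNReal) else 0)]
    · congr 1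
      have : ∀ r : Set.Ioi (0 : ℝ), (if r.1 < 1 then (1 : ENNReal) else 0)
        = (Set.Iio (⟨1, Set.mem_Ioi.2 one_pos⟩ : Set.Ioi (0 : ℝ))).indicator 1 r := fun r => by
        simp [Set.indicator_apply, ← Subtype.coe_lt_coe]
      simp_rw [this]
      rw [lintegral_indicator_one measurableSet_Iio, Measure.volumeIoiPow_apply_Iio]
      norm_num
    · exact (hΦ.comp measurable_subtype_coe).aemeasurable
    · refine (Measurable.ite ?_ measurable_const measurable_const).aemeasurable
      exact measurableSet_lt measurable_subtype_coe measurable_const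
  · refine (hΦ.comp (measurable_subtype_coe.comp measurable_fst)).mul ?_
    refine Measurable.ite ?_ measurable_const measurable_const
    exact measurableSet_lt (measurable_subtype_coe.comp measurable_snd) measurable_const

/-- The coordinates of a vector in an orthonormal basis, as a triple. -/
def coordTriple (e : OrthonormalBasis (Fin 3) ℝ Space3) (x : Space3) : ℝ × ℝ × ℝ :=
  (inner ℝ (e 0) x, inner ℝ (e 1) x, inner ℝ (e 2) x)

theorem continuous_coordTriple (e : OrthonormalBasis (Fin 3) ℝ Space3) :
    Continuous (coordTriple e) := by
  unfold coordTriple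
  fun_prop

theorem measurePreserving_coordTriple (e : OrthonormalBasis (Fin 3) ℝ Space3) :
    MeasurePreserving (coordTriple e) := by
  have h1 := volume_preserving_piFinSuccAbove (fun _ : Fin 3 => ℝ) 0
  have h2 := (MeasurePreserving.id (volume : Measure ℝ)).prod
    (volume_preserving_piFinTwo (fun _ : Fin 2 => ℝ))
  have h := (h2.comp h1).comp (measurePreserving_boxCoord e 0)
  have he : coordTriple e = (Prod.map id (MeasurableEquiv.piFinTwo fun _ : Fin 2 => ℝ) ∘
      MeasurableEquiv.piFinSuccAbove (fun _ : Fin 3 => ℝ) 0) ∘ boxCoord e 0 := by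
    ext x <;> simp [coordTriple, boxCoord_apply, MeasurableEquiv.piFinSuccAbove,
      OrthonormalBasis.repr_apply_apply, MeasurableEquiv.piFinTwo] <;> rfl
  rw [he]
  exact h

theorem norm_eq_sqrt_coordTriple (e : OrthonormalBasis (Fin 3) ℝ Space3) (x : Space3) :
    ‖x‖ = √((coordTriple e x).1 ^ 2 + (coordTriple e x).2.1 ^ 2 + (coordTriple e x).2.2 ^ 2) := by
  rw [← e.repr.norm_map, EuclideanSpace.norm_eq, Fin.sum_univ_three]
  simp [coordTriple, OrthonormalBasis.repr_apply_apply]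

theorem coordTriple_smul (e : OrthonormalBasis (Fin 3) ℝ Space3) (r : ℝ) (x : Space3) :
    coordTriple e (r • x) = r • coordTriple e x := by
  simp [coordTriple, inner_smul_right]

open Real in
/-- The point of the unit sphere with polar angle `ξ` and azimuth `φ`. -/
def sphericalPoint (ξ φ : ℝ) : ℝ × ℝ × ℝ := (cos ξ, sin ξ * cos φ, sin ξ * sin φ)

open Real in
theorem continuous_sphericalPoint : Continuous fun z : ℝ × ℝ => sphericalPoint z.1 z.2 := by
  unfold sphericalPoint
  fun_prop

open Set Real in
/-- Integration over the unit sphere in spherical coordinates. -/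
theorem lintegral_sphere (e : OrthonormalBasis (Fin 3) ℝ Space3) (f : ℝ × ℝ × ℝ → ENNReal)
    (hf : Measurable f) :
    ∫⁻ v : Metric.sphere (0 : Space3) 1, f (coordTriple e v) ∂(volume : Measure Space3).toSphere
      = ∫⁻ φ in Ioo (-π) π, ∫⁻ ξ in Ioo 0 π, ENNReal.ofReal (sin ξ) * f (sphericalPoint ξ φ) := by
  set N : ℝ × ℝ × ℝ → ℝ := fun p => √(p.1 ^ 2 + p.2.1 ^ 2 + p.2.2 ^ 2) with hN
  have hNm : Measurable N := by fun_prop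
  -- The extension of `f` that is constant along rays, cut off to the unit ball. Its volume integral
  -- is `1/3` of the sphere integral and also `1/3` of the integral over the angles, and the common
  -- factor is cancelled at the end.
  set G : ℝ × ℝ × ℝ → ENNReal := fun p => if N p < 1 then f ((N p)⁻¹ • p) else 0 with hG
  have hGm : Measurable G :=
    Measurable.ite (measurableSet_lt hNm measurable_const) (by fun_prop) measurable_const
  have h1 := lintegral_ball_direction (E := Space3) (by simp) (fun x => f (coordTriple e x))
    (hf.comp (continuous_coordTriple e).measurable)
  have h2 : ∫⁻ x : Space3, (if ‖x‖ < 1 then f (coordTriple e (‖x‖⁻¹ • x)) else 0)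
      = ∫⁻ p, G p := by
    rw [← (measurePreserving_coordTriple e).lintegral_comp hGm]
    refine lintegral_congr fun x => ?_
    simp only [hG, hN, ← norm_eq_sqrt_coordTriple e x, coordTriple_smul]
  have h3 : ∀ φ, ∀ ξ ∈ Ioo 0 π, ∫⁻ r in Ioi (0 : ℝ), ENNReal.ofReal (r ^ 2 * sin ξ) *
        G (r * cos ξ, r * (sin ξ * cos φ), r * (sin ξ * sin φ))
      = ENNReal.ofReal (1 / 3) * (ENNReal.ofReal (sin ξ) * f (sphericalPoint ξ φ)) := by
    intro φ ξ hξ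
    rw [← lintegral_radial_sq, ← lintegral_mul_const]
    · refine setLIntegral_congr_fun measurableSet_Ioi fun r hr => ?_
      have hr : 0 < r := hr
      have hNr : N (r * cos ξ, r * (sin ξ * cos φ), r * (sin ξ * sin φ)) = r := by
        have : (r * cos ξ) ^ 2 + (r * (sin ξ * cos φ)) ^ 2 + (r * (sin ξ * sin φ)) ^ 2 = r ^ 2 := by
          linear_combination r ^ 2 * sin ξ ^ 2 * sin_sq_add_cos_sq φ + r ^ 2 * sin_sq_add_cos_sq ξ
        simp only [hN, this, sqrt_sq hr.le]
      have hp : r⁻¹ • (r * cos ξ, r * (sin ξ * cos φ), r * (sin ξ * sin φ))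
          = sphericalPoint ξ φ := by
        simp [sphericalPoint, hr.ne']
      simp only [hG, hNr, hp]
      split_ifs
      · rw [ENNReal.ofReal_mul (by positivity), mul_assoc]
      · simp
    · exact Measurable.ite measurableSet_Iio (by fun_prop) measurable_const
  have h4 := lintegral_spherical G hGm
  rw [← h2, h1] at h4
  have h5 : ∀ φ, ∫⁻ ξ in Ioo 0 π, ∫⁻ r in Ioi (0 : ℝ), ENNReal.ofReal (r ^ 2 * sin ξ) *
        G (r * cos ξ, r * (sin ξ * cos φ), r * (sin ξ * sin φ))
      = ENNReal.ofReal (1 / 3) *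
        ∫⁻ ξ in Ioo 0 π, ENNReal.ofReal (sin ξ) * f (sphericalPoint ξ φ) := fun φ => by
    rw [setLIntegral_congr_fun measurableSet_Ioo (h3 φ), lintegral_const_mul' _ _ (by simp)]
  simp_rw [h5] at h4
  rw [lintegral_const_mul' _ _ (by simp), mul_comm] at h4
  refine (ENNReal.mul_right_inj ?_ ?_).1 h4 <;> simp

-- The reflections `φ ↦ -φ` and `φ ↦ π - φ` reduce the full circle to the first quadrant, where the
-- absolute values can be dropped.
open Set Real in
theorem integral_comp_abs_cos_abs_sin {h : ℝ → ℝ → ℝ} (hh : Continuous fun p : ℝ × ℝ => h p.1 p.2) :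
    ∫ φ in (-π)..π, h |cos φ| |sin φ| = 4 * ∫ φ in (0 : ℝ)..(π / 2), h (cos φ) (sin φ) := by
  have hc : Continuous fun φ => h |cos φ| |sin φ| :=
    hh.comp (continuous_cos.abs.prodMk continuous_sin.abs)
  have hi : ∀ x y, IntervalIntegrable (fun φ => h |cos φ| |sin φ|) volume x y :=
    fun x y => hc.intervalIntegrable x y
  have h1 : ∫ φ in (-π)..0, h |cos φ| |sin φ| = ∫ φ in (0 : ℝ)..π, h |cos φ| |sin φ| := by
    have := intervalIntegral.integral_comp_neg (a := 0) (b := π) fun φ => h |cos φ| |sin φ|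
    simp only [cos_neg, sin_neg, abs_neg, neg_zero] at this
    exact this.symm
  have h2 : ∫ φ in (π / 2)..π, h |cos φ| |sin φ| = ∫ φ in (0 : ℝ)..(π / 2), h |cos φ| |sin φ| := by
    have := intervalIntegral.integral_comp_sub_left (a := 0) (b := π / 2)
      (fun φ => h |cos φ| |sin φ|) π
    simp only [cos_pi_sub, sin_pi_sub, abs_neg, sub_zero] at this
    rw [this]
    congr 1
    ring
  have h3 : ∫ φ in (0 : ℝ)..(π / 2), h |cos φ| |sin φ|
      = ∫ φ in (0 : ℝ)..(π / 2), h (cos φ) (sin φ) := by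
    refine intervalIntegral.integral_congr fun φ hφ => ?_
    rw [uIcc_of_le (by positivity)] at hφ
    rw [abs_of_nonneg (cos_nonneg_of_mem_Icc ⟨by linarith [hφ.1, pi_pos], hφ.2⟩),
      abs_of_nonneg (sin_nonneg_of_mem_Icc ⟨hφ.1, by linarith [hφ.2, pi_pos]⟩)]
  rw [← intervalIntegral.integral_add_adjacent_intervals (hi (-π) 0) (hi 0 π), h1,
    ← intervalIntegral.integral_add_adjacent_intervals (hi 0 (π / 2)) (hi (π / 2) π), h2, h3]
  ring

open Set Real in
theorem integral_comp_abs_cos_sin {h : ℝ → ℝ → ℝ} (hh : Continuous fun p : ℝ × ℝ => h p.1 p.2) :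
    ∫ φ in (0 : ℝ)..π, h |cos φ| (sin φ) = 2 * ∫ φ in (0 : ℝ)..(π / 2), h (cos φ) (sin φ) := by
  have hc : Continuous fun φ => h |cos φ| (sin φ) :=
    hh.comp (continuous_cos.abs.prodMk continuous_sin)
  have hi : ∀ x y, IntervalIntegrable (fun φ => h |cos φ| (sin φ)) volume x y :=
    fun x y => hc.intervalIntegrable x y
  have h2 : ∫ φ in (π / 2)..π, h |cos φ| (sin φ) = ∫ φ in (0 : ℝ)..(π / 2), h |cos φ| (sin φ) := by
    have := intervalIntegral.integral_comp_sub_left (a := 0) (b := π / 2)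
      (fun φ => h |cos φ| (sin φ)) π
    simp only [cos_pi_sub, sin_pi_sub, abs_neg, sub_zero] at this
    rw [this]
    congr 1
    ring
  have h3 : ∫ φ in (0 : ℝ)..(π / 2), h |cos φ| (sin φ)
      = ∫ φ in (0 : ℝ)..(π / 2), h (cos φ) (sin φ) := by
    refine intervalIntegral.integral_congr fun φ hφ => ?_
    rw [uIcc_of_le (by positivity)] at hφ
    rw [abs_of_nonneg (cos_nonneg_of_mem_Icc ⟨by linarith [hφ.1, pi_pos], hφ.2⟩)]
  rw [← intervalIntegral.integral_add_adjacent_intervals (hi 0 (π / 2)) (hi (π / 2) π), h2, h3]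
  ring

-- Recasting the formula for nonnegative integrands as an identity of measures makes it available
-- for Bochner integrals of real functions of either sign, as in `integral_sphere`.
open Set Real in
theorem map_coordTriple_toSphere (e : OrthonormalBasis (Fin 3) ℝ Space3) :
    (volume : Measure Space3).toSphere.map
        (fun v : Metric.sphere (0 : Space3) 1 => coordTriple e v)
      = ((((volume : Measure ℝ).restrict (Ioo 0 π)).withDensity fun ξ => ENNReal.ofReal (sin ξ)).prod
          ((volume : Measure ℝ).restrict (Ioo (-π) π))).map fun z => sphericalPoint z.1 z.2 := by
  have hT : Measurable fun v : Metric.sphere (0 : Space3) 1 => coordTriple e v :=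
    ((continuous_coordTriple e).comp continuous_subtype_val).measurable
  have hω := continuous_sphericalPoint.measurable
  refine Measure.ext_of_lintegral _ fun f hf => ?_
  rw [lintegral_map hf hT, lintegral_map hf hω, lintegral_sphere e f hf,
    lintegral_prod (fun z : ℝ × ℝ => f (sphericalPoint z.1 z.2)) (hf.comp hω).aemeasurable,
    lintegral_withDensity_eq_lintegral_mul]
  · rw [lintegral_lintegral_swap]
    · refine lintegral_congr fun ξ => ?_
      rw [lintegral_const_mul' _ _ (by simp)]
      rfl
    · refine Measurable.aemeasurable ?_
      have := hf.comp (hω.comp measurable_swap)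
      exact Measurable.mul (by fun_prop) this
  · fun_prop
  · exact (hf.comp hω).lintegral_prod_right'

open Set Real in
theorem integral_sphere (e : OrthonormalBasis (Fin 3) ℝ Space3) (f : ℝ × ℝ × ℝ → ℝ)
    (hf : Continuous f) :
    ∫ v : Metric.sphere (0 : Space3) 1, f (coordTriple e v) ∂(volume : Measure Space3).toSphere
      = ∫ ξ in (0 : ℝ)..π, sin ξ * ∫ φ in (-π)..π, f (sphericalPoint ξ φ) := by
  have hT : Measurable fun v : Metric.sphere (0 : Space3) 1 => coordTriple e v :=
    ((continuous_coordTriple e).comp continuous_subtype_val).measurable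
  have hω := continuous_sphericalPoint
  rw [← integral_map (φ := fun v : Metric.sphere (0 : Space3) 1 => coordTriple e v)
    hT.aemeasurable hf.aestronglyMeasurable,
    map_coordTriple_toSphere, integral_map hω.measurable.aemeasurable hf.aestronglyMeasurable]
  have hfin : IsFiniteMeasure (((volume : Measure ℝ).restrict (Ioo 0 π)).withDensity
      fun ξ => ENNReal.ofReal (sin ξ)) := by
    refine isFiniteMeasure_withDensity_ofReal ?_
    exact (continuous_sin.integrableOn_Icc.mono_set Ioo_subset_Icc_self).2
  -- A bound for `f` on the cube `[-1, 1]³`, which contains the sphere; over a finite measure it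
  -- gives the integrability needed for Fubini.
  obtain ⟨C, hC⟩ := (isCompact_Icc (a := ((-1 : ℝ), (-1 : ℝ), (-1 : ℝ))) (b := (1, 1, 1))
    ).exists_bound_of_continuousOn hf.continuousOn
  rw [integral_prod]
  · have : ∀ ξ : ℝ, ENNReal.ofReal (sin ξ) = ((sin ξ).toNNReal : ENNReal) := fun ξ => rfl
    simp_rw [this]
    rw [integral_withDensity_eq_integral_smul (by fun_prop),
      intervalIntegral.integral_of_le pi_pos.le, integral_Ioc_eq_integral_Ioo]
    refine setIntegral_congr_fun measurableSet_Ioo fun ξ hξ => ?_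
    rw [intervalIntegral.integral_of_le (by linarith [pi_pos]), integral_Ioc_eq_integral_Ioo,
      NNReal.smul_def, Real.coe_toNNReal _ (sin_pos_of_mem_Ioo hξ).le, smul_eq_mul]
  · refine Integrable.of_bound (hf.comp hω).aestronglyMeasurable C
      (Filter.Eventually.of_forall fun z => hC _ ?_)
    have hp : ∀ x y : ℝ, |cos x| ≤ 1 ∧ |sin x * cos y| ≤ 1 ∧ |sin x * sin y| ≤ 1 := fun x y =>
      ⟨abs_cos_le_one x,
        by rw [abs_mul]; exact mul_le_one₀ (abs_sin_le_one x) (abs_nonneg _) (abs_cos_le_one y),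
        by rw [abs_mul]; exact mul_le_one₀ (abs_sin_le_one x) (abs_nonneg _) (abs_sin_le_one y)⟩
    obtain ⟨h1, h2, h3⟩ := hp z.1 z.2
    exact ⟨⟨(abs_le.1 h1).1, (abs_le.1 h2).1, (abs_le.1 h3).1⟩,
      ⟨(abs_le.1 h1).2, (abs_le.1 h2).2, (abs_le.1 h3).2⟩⟩

open Set Real in
/-- Integration over the sphere of a product of functions of the absolute coordinates. -/
theorem integral_sphere_prod (e : OrthonormalBasis (Fin 3) ℝ Space3) {α β γ : ℝ → ℝ}
    (hα : Continuous α) (hβ : Continuous β) (hγ : Continuous γ) :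
    ∫ v : Metric.sphere (0 : Space3) 1, α |inner ℝ (e 0) (v : Space3)| *
        (β |inner ℝ (e 1) (v : Space3)| * γ |inner ℝ (e 2) (v : Space3)|)
        ∂(volume : Measure Space3).toSphere
      = 8 * ∫ ξ in (0 : ℝ)..(π / 2), sin ξ * (α (cos ξ) *
          ∫ φ in (0 : ℝ)..(π / 2), β (sin ξ * cos φ) * γ (sin ξ * sin φ)) := by
  have h := integral_sphere e (fun p => α |p.1| * (β |p.2.1| * γ |p.2.2|)) (by fun_prop)
  refine h.trans ?_
  have h2 : ∀ ξ ∈ uIcc 0 π, sin ξ * ∫ φ in (-π)..π,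
      (fun p : ℝ × ℝ × ℝ => α |p.1| * (β |p.2.1| * γ |p.2.2|)) (sphericalPoint ξ φ)
      = (fun x s => 4 * (s * (α x * ∫ φ in (0 : ℝ)..(π / 2), β (s * cos φ) * γ (s * sin φ))))
          |cos ξ| (sin ξ) := by
    intro ξ hξ
    rw [uIcc_of_le pi_pos.le] at hξ
    have hs := sin_nonneg_of_mem_Icc hξ
    simp only [sphericalPoint, abs_mul, abs_of_nonneg hs]
    rw [intervalIntegral.integral_const_mul,
      integral_comp_abs_cos_abs_sin (h := fun x y => β (sin ξ * x) * γ (sin ξ * y)) (by fun_prop)]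
    ring
  rw [intervalIntegral.integral_congr h2, integral_comp_abs_cos_sin
    (h := fun x s => 4 * (s * (α x * ∫ φ in (0 : ℝ)..(π / 2), β (s * cos φ) * γ (s * sin φ))))]
  · rw [intervalIntegral.integral_const_mul]
    ring
  · have : Continuous fun p : ℝ × ℝ => ∫ φ in (0 : ℝ)..(π / 2), β (p.2 * cos φ) * γ (p.2 * sin φ) := by
      refine intervalIntegral.continuous_parametric_intervalIntegral_of_continuous' ?_ 0 (π / 2)
      simp only [Function.uncurry_def]
      fun_prop
    fun_prop

/-! ### Azimuthal integrals, the whole sphere and a single cap -/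

open Set Real in
theorem integral_quarter_sub_mul_sub (b c r : ℝ) :
    ∫ φ in (0 : ℝ)..(π / 2), (b - r * cos φ) * (c - r * sin φ)
      = b * c * π / 2 - (b + c) * r + r ^ 2 / 2 := by
  have hd : ∀ φ ∈ uIcc 0 (π / 2), HasDerivAt
      (fun φ => b * c * φ + b * r * cos φ - c * r * sin φ + r ^ 2 / 2 * sin φ ^ 2)
      ((b - r * cos φ) * (c - r * sin φ)) φ := fun φ _ => by
    have := ((((hasDerivAt_id φ).const_mul (b * c)).add ((hasDerivAt_cos φ).const_mul (b * r))).sub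
      ((hasDerivAt_sin φ).const_mul (c * r))).add (((hasDerivAt_sin φ).pow 2).const_mul (r ^ 2 / 2))
    refine this.congr_deriv ?_
    simp
    ring
  rw [intervalIntegral.integral_eq_sub_of_hasDerivAt hd
    (Continuous.intervalIntegrable (by fun_prop) _ _)]
  simp
  ring

open Set Real in
/-- An integral over an interval of a function which vanishes beyond a point. -/
theorem integral_eq_integral_of_eq_zero {f g : ℝ → ℝ} {x y z : ℝ} (hxy : x ≤ y) (hyz : y ≤ z)
    (hf : Continuous f) (hg : ∀ w ∈ Icc x y, f w = g w) (h0 : ∀ w ∈ Icc y z, f w = 0) :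
    ∫ w in x..z, f w = ∫ w in x..y, g w := by
  rw [← intervalIntegral.integral_add_adjacent_intervals (hf.intervalIntegrable x y)
    (hf.intervalIntegrable y z),
    intervalIntegral.integral_congr (g := fun _ => 0) (a := y) (b := z) (by rwa [uIcc_of_le hyz]),
    intervalIntegral.integral_zero, add_zero]
  exact intervalIntegral.integral_congr (by rwa [uIcc_of_le hxy])

-- For `r > b` the positive part cuts the integral off at the angle `arccos (b / r)`, whose tangent
-- is `√(r² - b²) / b`. The arctangent form of this angle is the one that is integrated over `ξ`
-- later on.
open Set Real in
theorem integral_quarter_posPart_mul_sub {b r : ℝ} (c : ℝ) (hb : 0 < b) (hr : 0 ≤ r) :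
    ∫ φ in (0 : ℝ)..(π / 2), max (r * cos φ - b) 0 * (c - r * sin φ)
      = if r ≤ b then 0 else
        c * √(r ^ 2 - b ^ 2) - b * c * arctan (√(r ^ 2 - b ^ 2) / b) - (r - b) ^ 2 / 2 := by
  split_ifs with h
  · have : ∀ φ ∈ uIcc 0 (π / 2), max (r * cos φ - b) 0 * (c - r * sin φ) = 0 := fun φ _ => by
      rw [max_eq_right, zero_mul]
      nlinarith [cos_le_one φ]
    rw [intervalIntegral.integral_congr this, intervalIntegral.integral_zero]
  · push Not at h
    have hr : 0 < r := hb.trans h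
    have hbr : b / r ≤ 1 := (div_le_one hr).2 h.le
    have hbr0 : 0 < b / r := by positivity
    set φ₀ := arccos (b / r) with hφ₀
    have h0 : 0 ≤ φ₀ := arccos_nonneg _
    have h1 : φ₀ ≤ π / 2 := arccos_le_pi_div_two.2 hbr0.le
    have hcos : r * cos φ₀ = b := by
      rw [hφ₀, cos_arccos (by linarith) hbr]; field_simp
    have hsq : √(r ^ 2 - b ^ 2) = r * √(1 - (b / r) ^ 2) := by
      rw [← sqrt_sq hr.le, ← sqrt_mul (by positivity), sqrt_sq hr.le]
      congr 1; field_simp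
    have hsin : r * sin φ₀ = √(r ^ 2 - b ^ 2) := by rw [hφ₀, sin_arccos, hsq]
    have hatan : arctan (√(r ^ 2 - b ^ 2) / b) = φ₀ := by
      rw [hφ₀, arccos_eq_arctan hbr0, hsq]; congr 1; field_simp
    rw [integral_eq_integral_of_eq_zero (g := fun φ => (r * cos φ - b) * (c - r * sin φ)) h0 h1
      (by fun_prop)]
    · have hd : ∀ φ ∈ uIcc 0 φ₀, HasDerivAt
          (fun φ => c * r * sin φ - b * c * φ - r ^ 2 / 2 * sin φ ^ 2 - b * r * cos φ)
          ((r * cos φ - b) * (c - r * sin φ)) φ := fun φ _ => by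
        have := ((((hasDerivAt_sin φ).const_mul (c * r)).sub
          ((hasDerivAt_id φ).const_mul (b * c))).sub
          (((hasDerivAt_sin φ).pow 2).const_mul (r ^ 2 / 2))).sub
          ((hasDerivAt_cos φ).const_mul (b * r))
        refine this.congr_deriv ?_
        simp
        ring
      rw [intervalIntegral.integral_eq_sub_of_hasDerivAt hd
        (Continuous.intervalIntegrable (by fun_prop) _ _), hatan, ← hsin]
      simp only [sin_zero, cos_zero]
      have := sin_sq_add_cos_sq φ₀
      rw [← hcos]
      linear_combination (-(r ^ 2) / 2) * this
    · intro φ hφ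
      have : cos φ₀ ≤ cos φ := cos_le_cos_of_nonneg_of_le_pi hφ.1 (by linarith [pi_pos]) hφ.2
      rw [max_eq_left]
      nlinarith
    · intro φ hφ
      have : cos φ ≤ cos φ₀ := cos_le_cos_of_nonneg_of_le_pi h0 (by linarith [pi_pos, hφ.2]) hφ.1
      rw [max_eq_right, zero_mul]
      nlinarith

/-- The contribution of the full sphere, without cut-off. -/
def tau0 (a b c t : ℝ) : ℝ :=
  8 * (a * b * c * Real.pi / 2 - t * (a * b + b * c + c * a) * Real.pi / 4
    + t ^ 2 * (a + b + c) / 3 - t ^ 3 / 8)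

/-- The contribution of a cap. -/
def tau1 (a b c t : ℝ) : ℝ :=
  8 * (b * c * Real.pi * (t - 2 * a + a ^ 2 / t) / 4
    - (b + c) * ((2 * t + a ^ 2 / t) * √(t ^ 2 - a ^ 2) / 6 - a * t / 2 * Real.arccos (a / t))
    + t ^ 3 / 8 - a * t ^ 2 / 3 + a ^ 2 * t / 4 - a ^ 4 / (24 * t))

-- Once the azimuth is integrated out, what remains is a trigonometric polynomial in `ξ`. The same
-- primitive serves the whole sphere, with the sign reversed, and the cap.
open Set Real in
theorem hasDerivAt_cap_primitive (a b c t ξ : ℝ) :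
    HasDerivAt (fun ξ => b * c * π / 2 * (t * sin ξ ^ 2 / 2 + a * cos ξ)
      - (b + c) * t * (t * sin ξ ^ 3 / 3 - a * (ξ - sin ξ * cos ξ) / 2)
      + t ^ 2 / 2 * (t * sin ξ ^ 4 / 4 - a * (cos ξ ^ 3 / 3 - cos ξ)))
      (sin ξ * ((t * cos ξ - a) *
        (b * c * π / 2 - (b + c) * (t * sin ξ) + (t * sin ξ) ^ 2 / 2))) ξ := by
  have hs := hasDerivAt_sin ξ
  have hc := hasDerivAt_cos ξ
  have h1 := ((((hs.pow 2).const_mul t).div_const 2).add (hc.const_mul a)).const_mul (b * c * π / 2)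
  have h2 := ((((hs.pow 3).const_mul t).div_const 3).sub
    ((((hasDerivAt_id ξ).sub (hs.mul hc)).const_mul a).div_const 2)).const_mul ((b + c) * t)
  have h3 := ((((hs.pow 4).const_mul t).div_const 4).sub
    ((((hc.pow 3).div_const 3).sub hc).const_mul a)).const_mul (t ^ 2 / 2)
  refine ((h1.sub h2).add h3).congr_deriv ?_
  simp only [Nat.cast_ofNat, Nat.reduceSub, pow_one]
  have hcos : cos ξ * cos ξ = 1 - sin ξ * sin ξ := by linear_combination sin_sq_add_cos_sq ξ
  linear_combination (-(b + c) * t * a / 2 + t ^ 2 / 2 * a * sin ξ) * hcos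

open Set Real in
theorem integral_sphere_linear (e : OrthonormalBasis (Fin 3) ℝ Space3) (a b c t : ℝ) :
    ∫ v : Metric.sphere (0 : Space3) 1, (a - t * |inner ℝ (e 0) (v : Space3)|) *
        ((b - t * |inner ℝ (e 1) (v : Space3)|) * (c - t * |inner ℝ (e 2) (v : Space3)|))
        ∂(volume : Measure Space3).toSphere = tau0 a b c t := by
  rw [integral_sphere_prod e (α := fun x => a - t * x) (β := fun x => b - t * x)
    (γ := fun x => c - t * x) (by fun_prop) (by fun_prop) (by fun_prop)]
  have h : ∀ ξ, sin ξ * ((a - t * cos ξ) * ∫ φ in (0 : ℝ)..(π / 2),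
      (b - t * (sin ξ * cos φ)) * (c - t * (sin ξ * sin φ)))
      = - (sin ξ * ((t * cos ξ - a) *
        (b * c * π / 2 - (b + c) * (t * sin ξ) + (t * sin ξ) ^ 2 / 2))) := fun ξ => by
    simp_rw [← mul_assoc t]
    rw [integral_quarter_sub_mul_sub]
    ring
  simp_rw [h]
  rw [intervalIntegral.integral_neg, intervalIntegral.integral_eq_sub_of_hasDerivAt
    (fun ξ _ => hasDerivAt_cap_primitive a b c t ξ)
    (Continuous.intervalIntegrable (by fun_prop) _ _)]
  simp [tau0]
  ring

-- The cap ends at the polar angle `arccos (a / t)`. It is empty for `t ≤ a`, and `tau1` vanishes at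
-- `a`, so freezing its argument at `a` covers this case as well.
open Set Real in
theorem integral_sphere_cap (e : OrthonormalBasis (Fin 3) ℝ Space3) {a t : ℝ} (b c : ℝ)
    (ha : 0 < a) (ht : 0 < t) :
    ∫ v : Metric.sphere (0 : Space3) 1, max (t * |inner ℝ (e 0) (v : Space3)| - a) 0 *
        ((b - t * |inner ℝ (e 1) (v : Space3)|) * (c - t * |inner ℝ (e 2) (v : Space3)|))
        ∂(volume : Measure Space3).toSphere = tau1 a b c (max t a) := by
  rw [integral_sphere_prod e (α := fun x => max (t * x - a) 0) (β := fun x => b - t * x)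
    (γ := fun x => c - t * x) (by fun_prop) (by fun_prop) (by fun_prop)]
  have h : ∀ ξ, sin ξ * (max (t * cos ξ - a) 0 * ∫ φ in (0 : ℝ)..(π / 2),
      (b - t * (sin ξ * cos φ)) * (c - t * (sin ξ * sin φ)))
      = sin ξ * (max (t * cos ξ - a) 0 *
        (b * c * π / 2 - (b + c) * (t * sin ξ) + (t * sin ξ) ^ 2 / 2)) := fun ξ => by
    simp_rw [← mul_assoc t]
    rw [integral_quarter_sub_mul_sub]
  simp_rw [h]
  rcases le_or_gt t a with hta | hta
  · rw [max_eq_right hta, intervalIntegral.integral_congr (g := fun _ => 0),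
      intervalIntegral.integral_zero]
    · rw [tau1, div_self ha.ne', arccos_one]
      field_simp
      ring_nf
      simp
    · intro ξ _
      have : max (t * cos ξ - a) 0 = 0 := max_eq_right (by nlinarith [cos_le_one ξ])
      simp [this]
  · rw [max_eq_left hta.le]
    have hbr : a / t ≤ 1 := (div_le_one ht).2 hta.le
    have hbr0 : 0 < a / t := by positivity
    set ξ₀ := arccos (a / t) with hξ₀
    have h0 : 0 ≤ ξ₀ := arccos_nonneg _
    have h1 : ξ₀ ≤ π / 2 := arccos_le_pi_div_two.2 hbr0.le
    have hcos : cos ξ₀ = a / t := by rw [hξ₀, cos_arccos (by linarith) hbr]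
    have hcos' : t * cos ξ₀ = a := by rw [hcos]; field_simp
    have hsin : sin ξ₀ = √(t ^ 2 - a ^ 2) / t := by
      rw [hξ₀, sin_arccos, eq_div_iff ht.ne', ← sqrt_sq ht.le, ← sqrt_mul', sqrt_sq ht.le]
      · congr 1; field_simp
      · positivity
    rw [integral_eq_integral_of_eq_zero (g := fun ξ => sin ξ * ((t * cos ξ - a) *
        (b * c * π / 2 - (b + c) * (t * sin ξ) + (t * sin ξ) ^ 2 / 2))) h0 h1 (by fun_prop),
      intervalIntegral.integral_eq_sub_of_hasDerivAt
      (fun ξ _ => hasDerivAt_cap_primitive a b c t ξ)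
      (Continuous.intervalIntegrable (by fun_prop) _ _)]
    · rw [hcos, hsin, tau1, ← hξ₀]
      have hu : √(t ^ 2 - a ^ 2) ^ 2 = t ^ 2 - a ^ 2 := sq_sqrt (by nlinarith)
      generalize √(t ^ 2 - a ^ 2) = u at hu ⊢
      have hu3 : u ^ 3 = (t ^ 2 - a ^ 2) * u := by rw [← hu]; ring
      have hu4 : u ^ 4 = (t ^ 2 - a ^ 2) ^ 2 := by rw [← hu]; ring
      simp only [div_pow, hu, hu3, hu4, sin_zero, cos_zero]
      field_simp
      ring
    · intro ξ hξ
      have : cos ξ₀ ≤ cos ξ := cos_le_cos_of_nonneg_of_le_pi hξ.1 (by linarith [pi_pos]) hξ.2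
      rw [max_eq_left]
      nlinarith
    · intro ξ hξ
      have : cos ξ ≤ cos ξ₀ := cos_le_cos_of_nonneg_of_le_pi h0 (by linarith [pi_pos, hξ.2]) hξ.1
      rw [max_eq_right, zero_mul, mul_zero]
      nlinarith

/-! ### The intersection of two caps -/

/-- The contribution of the intersection of two caps. -/
def tau2 (a b c t : ℝ) : ℝ :=
  8 * c * ((√(t ^ 2 - a ^ 2 - b ^ 2) ^ 3 / 3 + (a ^ 2 + b ^ 2) * √(t ^ 2 - a ^ 2 - b ^ 2) / 2) / t
    - a * (t + b ^ 2 / t) / 2 * Real.arctan (√(t ^ 2 - a ^ 2 - b ^ 2) / a)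
    - b * (t + a ^ 2 / t) / 2 * Real.arctan (√(t ^ 2 - a ^ 2 - b ^ 2) / b)
    + a * b * Real.arctan (t * √(t ^ 2 - a ^ 2 - b ^ 2) / (a * b)))
  - 8 * (t ^ 3 / 8 + (a ^ 2 + b ^ 2) * t / 4 + (6 * a ^ 2 * b ^ 2 - a ^ 4 - b ^ 4) / (24 * t)
    - a * √(t ^ 2 - b ^ 2) * (2 * t + b ^ 2 / t) / 6
    - b * √(t ^ 2 - a ^ 2) * (2 * t + a ^ 2 / t) / 6
    + a * b * t / 2 * (Real.arccos (a / t) - Real.arcsin (b / t)))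

open Real in
/-- A primitive for the integral over the intersection of two caps, in terms of the
coordinates `x = t cos ξ`, `u = t sin ξ`, `s = √(u² - b²)`. -/
def lensPrimitive (a b c t x u s ξ : ℝ) : ℝ :=
  -(c * (-s ^ 3 / 3 - a * (x * s - (t ^ 2 - b ^ 2) * arctan (s / x)) / 2)
    - b * c * ((x ^ 2 - t ^ 2) / 2 * arctan (s / b) + b * s / 2
      - a * (x * arctan (s / b) + b * arctan (s / x) - t * arctan (t * s / (b * x))))
    - (((t ^ 2 + b ^ 2) * (x - a) ^ 2 / 2 - x ^ 4 / 4 + a * x ^ 3 / 3) / 2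
      - b * (-u ^ 3 / 3 - a * (x * u - t ^ 2 * ξ) / 2))) / t

-- Since `dx = -u dξ` and `sin ξ = u / t`, the factor `-1 / t` in front reduces the claim to three
-- separate primitives: for the term with `c s`, for the term with `b c arctan (s / b)`, and for the
-- term free of `c`. Each is verified with `x² + u² = t²` and `s² = u² - b²`. The strict inequality
-- `b < u` keeps `s` away from zero, where the square root is not differentiable.
open Real in
theorem hasDerivAt_lensPrimitive {a b c t ξ x u s : ℝ} (hb : 0 < b) (ht : 0 < t)
    (hx : x = t * cos ξ) (hu : u = t * sin ξ) (hx0 : 0 < x) (hbu : b < u)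
    (hs : s = √(u ^ 2 - b ^ 2)) :
    HasDerivAt (fun ξ => lensPrimitive a b c t (t * cos ξ) (t * sin ξ)
      (√((t * sin ξ) ^ 2 - b ^ 2)) ξ)
      (sin ξ * ((x - a) * (c * s - b * c * arctan (s / b) - (u - b) ^ 2 / 2))) ξ := by
  have hu0 : 0 < u := hb.trans hbu
  have hpos : 0 < u ^ 2 - b ^ 2 := by nlinarith
  have hs0 : 0 < s := hs ▸ sqrt_pos.2 hpos
  have hs2 : s ^ 2 = u ^ 2 - b ^ 2 := by rw [hs, sq_sqrt hpos.le]
  have hxu : x ^ 2 + u ^ 2 = t ^ 2 := by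
    rw [hx, hu]; linear_combination t ^ 2 * sin_sq_add_cos_sq ξ
  have dx : HasDerivAt (fun ξ => t * cos ξ) (-u) ξ := by
    refine ((hasDerivAt_cos ξ).const_mul t).congr_deriv ?_
    rw [hu]; ring
  have du : HasDerivAt (fun ξ => t * sin ξ) x ξ := by
    refine ((hasDerivAt_sin ξ).const_mul t).congr_deriv ?_
    rw [hx]
  have ds : HasDerivAt (fun ξ => √((t * sin ξ) ^ 2 - b ^ 2)) (x * u / s) ξ := by
    have := ((du.pow 2).sub_const (b ^ 2)).sqrt (by simpa [← hu] using hpos.ne')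
    refine this.congr_deriv ?_
    simp only [Pi.pow_apply, ← hu, ← hs, Nat.cast_ofNat, Nat.reduceSub, pow_one]
    field_simp
  have dab : HasDerivAt (fun ξ => arctan (√((t * sin ξ) ^ 2 - b ^ 2) / b)) (b * x / (s * u)) ξ := by
    refine (ds.div_const b).arctan.congr_deriv ?_
    simp only [← hu, ← hs]
    have : 1 + (s / b) ^ 2 = u ^ 2 / b ^ 2 := by field_simp; linarith
    rw [this]
    field_simp
  have dax : HasDerivAt (fun ξ => arctan (√((t * sin ξ) ^ 2 - b ^ 2) / (t * cos ξ))) (u / s) ξ := by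
    refine (ds.div dx (hx ▸ hx0.ne')).arctan.congr_deriv ?_
    simp only [Pi.div_apply, ← hu, ← hs, ← hx]
    have : 1 + (s / x) ^ 2 = (x ^ 2 + s ^ 2) / x ^ 2 := by field_simp
    rw [this]
    field_simp
    ring
  have datx : HasDerivAt (fun ξ => arctan (t * √((t * sin ξ) ^ 2 - b ^ 2) / (b * (t * cos ξ))))
      (b * t / (s * u)) ξ := by
    have hne : b * (t * cos ξ) ≠ 0 := by rw [← hx]; positivity
    refine ((ds.const_mul t).div (dx.const_mul b) hne).arctan.congr_deriv ?_
    simp only [Pi.div_apply, ← hu, ← hs, ← hx]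
    have h1 : 1 + (t * s / (b * x)) ^ 2 = (t ^ 2 - b ^ 2) * u ^ 2 / (b ^ 2 * x ^ 2) := by
      field_simp
      rw [hs2]
      linear_combination (b ^ 2) * hxu
    have h2 : 0 < t ^ 2 - b ^ 2 := by nlinarith [sq_nonneg x]
    rw [h1]
    have h3 : t * (x * u / s) * (b * x) - t * s * (b * -u)
        = t * b * u * (t ^ 2 - b ^ 2) / s := by
      field_simp
      rw [hs2]; linear_combination hxu
    rw [h3]
    field_simp
  unfold lensPrimitive
  have ht2 : t ^ 2 = x ^ 2 + u ^ 2 := hxu.symm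
  have h1 := ((ds.pow 3).neg.div_const 3).sub
    ((((dx.mul ds).sub (dax.const_mul (t ^ 2 - b ^ 2))).const_mul a).div_const 2)
  replace h1 := h1.congr_deriv (g' := -u * (x - a) * s) (by
    simp only [← hu, ← hs, ← hx, Nat.cast_ofNat, Nat.reduceSub]
    field_simp
    have hb2 : b ^ 2 = u ^ 2 - s ^ 2 := by linarith
    rw [ht2, hb2]
    ring)
  have h2 := ((((dx.pow 2).sub_const (t ^ 2)).div_const 2).mul dab).add
    ((ds.const_mul b).div_const 2) |>.sub ((((dx.mul dab).add (dax.const_mul b)).sub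
      (datx.const_mul t)).const_mul a)
  replace h2 := h2.congr_deriv (g' := -u * (x - a) * arctan (s / b)) (by
    simp only [Pi.pow_apply, ← hu, ← hs, ← hx, Nat.cast_ofNat, Nat.reduceSub, pow_one]
    generalize arctan (s / b) = A
    field_simp
    rw [ht2]
    ring)
  have h3 := (((((((dx.sub_const a).pow 2).const_mul (t ^ 2 + b ^ 2)).div_const 2).sub
    ((dx.pow 4).div_const 4)).add (((dx.pow 3).const_mul a).div_const 3)).div_const 2).sub
    ((((du.pow 3).neg.div_const 3).sub ((((dx.mul du).sub
      ((hasDerivAt_id ξ).const_mul (t ^ 2))).const_mul a).div_const 2)).const_mul b)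
  replace h3 := h3.congr_deriv (g' := -u * (x - a) * ((u - b) ^ 2 / 2)) (by
    simp only [← hu, ← hx, Nat.cast_ofNat, Nat.reduceSub, pow_one]
    rw [ht2]
    ring)
  refine ((((h1.const_mul c).sub (h2.const_mul (b * c))).sub h3).neg.div_const t).congr_deriv ?_
  have hsin : sin ξ = u / t := by rw [hu]; field_simp
  rw [hsin]
  ring

-- At the threshold the two cut-off angles `arccos (a / t)` and `arcsin (b / t)` coincide, so the
-- range of integration shrinks to a point.
open Real in
theorem tau2_threshold {a b : ℝ} (c : ℝ) (ha : 0 < a) (hb : 0 < b) :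
    tau2 a b c √(a ^ 2 + b ^ 2) = 0 := by
  have h0 : 0 < a ^ 2 + b ^ 2 := by positivity
  set h := √(a ^ 2 + b ^ 2) with hh
  have hpos : 0 < h := sqrt_pos.2 h0
  have h2 : h ^ 2 = a ^ 2 + b ^ 2 := sq_sqrt h0.le
  have e1 : √(h ^ 2 - a ^ 2 - b ^ 2) = 0 := by rw [h2]; simp
  have e2 : √(h ^ 2 - b ^ 2) = a := by rw [h2]; simp [ha.le]
  have e3 : √(h ^ 2 - a ^ 2) = b := by rw [h2]; simp [hb.le]
  have e4 : arccos (a / h) = arcsin (b / h) := by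
    rw [arccos_eq_arcsin (by positivity)]
    congr 1
    rw [show 1 - (a / h) ^ 2 = (b / h) ^ 2 by field_simp; linarith, sqrt_sq (by positivity)]
  simp only [tau2, e1, e2, e3, e4]
  simp only [zero_div, mul_zero, arctan_zero, sub_self]
  field_simp
  have h4 : h ^ 4 = (a ^ 2 + b ^ 2) ^ 2 := by rw [← h2]; ring
  ring_nf
  rw [h4, h2]
  ring

-- The arguments are the values of `x`, `u`, `s`, `ξ` at the two ends of the range: at `arccos (a /
-- t)` one has `x = a`, and at `arcsin (b / t)` one has `u = b` and `s = 0`. The factor 8 counts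
-- octants.
open Real in
theorem lensPrimitive_sub_eq_tau2 {a b t : ℝ} (c : ℝ) (ht : 0 < t) (h : a ^ 2 + b ^ 2 ≤ t ^ 2) :
    8 * (lensPrimitive a b c t a √(t ^ 2 - a ^ 2) √(t ^ 2 - a ^ 2 - b ^ 2) (arccos (a / t))
      - lensPrimitive a b c t √(t ^ 2 - b ^ 2) b 0 (arcsin (b / t))) = tau2 a b c t := by
  have hu : √(t ^ 2 - a ^ 2) ^ 2 = t ^ 2 - a ^ 2 := sq_sqrt (by linarith [sq_nonneg b])
  have hB : √(t ^ 2 - b ^ 2) ^ 2 = t ^ 2 - b ^ 2 := sq_sqrt (by linarith [sq_nonneg a])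
  have hs : √(t ^ 2 - a ^ 2 - b ^ 2) ^ 2 = t ^ 2 - a ^ 2 - b ^ 2 := sq_sqrt (by linarith)
  simp only [tau2, lensPrimitive, zero_div, mul_zero, arctan_zero, mul_comm b a]
  generalize √(t ^ 2 - a ^ 2) = u at hu ⊢
  generalize √(t ^ 2 - b ^ 2) = B at hB ⊢
  generalize √(t ^ 2 - a ^ 2 - b ^ 2) = s at hs ⊢
  generalize arctan (s / a) = A1
  generalize arctan (s / b) = A2
  generalize arctan (t * s / (a * b)) = A3
  generalize arccos (a / t) = X1
  generalize arcsin (b / t) = X2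
  have hu3 : u ^ 3 = (t ^ 2 - a ^ 2) * u := by rw [← hu]; ring
  have hB3 : B ^ 3 = (t ^ 2 - b ^ 2) * B := by rw [← hB]; ring
  have hB4 : B ^ 4 = (t ^ 2 - b ^ 2) ^ 2 := by rw [← hB]; ring
  have hs3 : s ^ 3 = (t ^ 2 - a ^ 2 - b ^ 2) * s := by rw [← hs]; ring
  field_simp
  ring_nf
  simp only [hu3, hB3, hB4, hs3, hB]
  ring

open Set Real in
theorem integral_sphere_lens (e : OrthonormalBasis (Fin 3) ℝ Space3) {a b t : ℝ} (c : ℝ)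
    (ha : 0 < a) (hb : 0 < b) (ht : 0 < t) :
    ∫ v : Metric.sphere (0 : Space3) 1, max (t * |inner ℝ (e 0) (v : Space3)| - a) 0 *
        (max (t * |inner ℝ (e 1) (v : Space3)| - b) 0 * (c - t * |inner ℝ (e 2) (v : Space3)|))
        ∂(volume : Measure Space3).toSphere = tau2 a b c (max t √(a ^ 2 + b ^ 2)) := by
  rw [integral_sphere_prod e (α := fun x => max (t * x - a) 0) (β := fun x => max (t * x - b) 0)
    (γ := fun x => c - t * x) (by fun_prop) (by fun_prop) (by fun_prop)]
  -- The azimuthal integral in closed form. Because `q b = 0`, its vanishing for `t sin ξ ≤ b` can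
  -- be expressed by `max (t sin ξ) b`, which makes the integrand visibly continuous.
  set q : ℝ → ℝ := fun r =>
    c * √(r ^ 2 - b ^ 2) - b * c * arctan (√(r ^ 2 - b ^ 2) / b) - (r - b) ^ 2 / 2 with hq
  have hqb : q b = 0 := by simp [hq]
  have hqc : Continuous q := by fun_prop
  set f : ℝ → ℝ := fun ξ => sin ξ * (max (t * cos ξ - a) 0 * q (max (t * sin ξ) b)) with hf
  have hfc : Continuous f := by fun_prop
  have h : ∀ ξ ∈ uIcc 0 (π / 2), sin ξ * (max (t * cos ξ - a) 0 * ∫ φ in (0 : ℝ)..(π / 2),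
      max (t * (sin ξ * cos φ) - b) 0 * (c - t * (sin ξ * sin φ))) = f ξ := fun ξ hξ => by
    rw [uIcc_of_le (by positivity)] at hξ
    have hs := sin_nonneg_of_mem_Icc ⟨hξ.1, by linarith [hξ.2, pi_pos]⟩
    simp_rw [← mul_assoc t]
    rw [integral_quarter_posPart_mul_sub c hb (by positivity), hf]
    split_ifs with h
    · simp only [max_eq_right h, hqb]
    · simp only [max_eq_left (not_le.1 h).le, hq]
  rw [intervalIntegral.integral_congr h]
  have h0 : 0 < a ^ 2 + b ^ 2 := by positivity
  rcases le_or_gt t √(a ^ 2 + b ^ 2) with hta | hta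
  · rw [max_eq_right hta, tau2_threshold c ha hb, intervalIntegral.integral_congr (g := fun _ => 0),
      intervalIntegral.integral_zero, mul_zero]
    intro ξ _
    have ht2 : t ^ 2 ≤ a ^ 2 + b ^ 2 := by
      rw [← sq_sqrt h0.le]; gcongr
    rcases le_or_gt (t * cos ξ) a with h1 | h1
    · simp [hf, max_eq_right (sub_nonpos.2 h1)]
    · rcases le_or_gt (t * sin ξ) b with h2 | h2
      · simp [hf, max_eq_right h2, hqb]
      · exfalso
        -- Both caps at once would force `a² + b² < t²`.
        nlinarith [sin_sq_add_cos_sq ξ, mul_pos ha ha, mul_pos hb hb]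
  · rw [max_eq_left hta.le]
    have ht2 : a ^ 2 + b ^ 2 < t ^ 2 := by
      rw [← sq_sqrt h0.le]; gcongr
    have hat : a < t := by nlinarith
    have hbt : b < t := by nlinarith
    have ha1 : a / t ≤ 1 := (div_le_one ht).2 hat.le
    have ha0 : 0 < a / t := by positivity
    have hb1 : b / t ≤ 1 := (div_le_one ht).2 hbt.le
    have hb0 : 0 < b / t := by positivity
    -- The integrand lives between these angles: the second cap needs `t sin ξ > b`, the first `t
    -- cos ξ > a`.
    set ξ₁ := arcsin (b / t) with hξ₁
    set ξ₂ := arccos (a / t) with hξ₂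
    have h0 : 0 ≤ ξ₁ := arcsin_nonneg.2 hb0.le
    have h1 : ξ₂ ≤ π / 2 := arccos_le_pi_div_two.2 ha0.le
    have hsq : ∀ y, 0 < y → √(1 - (y / t) ^ 2) = √(t ^ 2 - y ^ 2) / t := fun y hy => by
      rw [eq_div_iff ht.ne']
      conv_lhs => rw [← sqrt_sq ht.le, ← sqrt_mul' _ (by positivity), sqrt_sq ht.le]
      congr 1; field_simp
    have h12 : ξ₁ ≤ ξ₂ := by
      rw [hξ₁, hξ₂, arccos_eq_arcsin ha0.le]
      refine arcsin_le_arcsin (le_sqrt_of_sq_le ?_)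
      rw [div_pow, div_pow, le_sub_iff_add_le, ← add_div, div_le_one (by positivity)]
      linarith
    have hcos2 : t * cos ξ₂ = a := by rw [hξ₂, cos_arccos (by linarith) ha1]; field_simp
    have hsin2 : t * sin ξ₂ = √(t ^ 2 - a ^ 2) := by
      rw [hξ₂, sin_arccos, hsq a ha]; field_simp
    have hsin1 : t * sin ξ₁ = b := by rw [hξ₁, sin_arcsin (by linarith) hb1]; field_simp
    have hcos1 : t * cos ξ₁ = √(t ^ 2 - b ^ 2) := by
      rw [hξ₁, cos_arcsin, hsq b hb]; field_simp
    have hi : ∀ x y, IntervalIntegrable f volume x y := fun x y => hfc.intervalIntegrable x y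
    have hleft : ∫ ξ in (0 : ℝ)..ξ₁, f ξ = 0 := by
      rw [intervalIntegral.integral_congr (g := fun _ => 0), intervalIntegral.integral_zero]
      intro ξ hξ
      rw [uIcc_of_le h0] at hξ
      have : sin ξ ≤ sin ξ₁ := sin_le_sin_of_le_of_le_pi_div_two (by linarith [pi_pos, hξ.1])
        (h12.trans h1) hξ.2
      have : t * sin ξ ≤ b := by nlinarith
      simp [hf, max_eq_right this, hqb]
    have hmem : ∀ ξ ∈ Ioo ξ₁ ξ₂, a < t * cos ξ ∧ b < t * sin ξ := fun ξ hξ => by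
      have hs : sin ξ₁ < sin ξ := sin_lt_sin_of_lt_of_le_pi_div_two (by linarith [pi_pos])
        (hξ.2.le.trans h1) hξ.1
      have hc : cos ξ₂ < cos ξ := cos_lt_cos_of_nonneg_of_le_pi_div_two (h0.trans hξ.1.le) h1 hξ.2
      constructor <;> nlinarith
    have hmid : ∫ ξ in ξ₁..ξ₂, f ξ
        = lensPrimitive a b c t (t * cos ξ₂) (t * sin ξ₂) (√((t * sin ξ₂) ^ 2 - b ^ 2)) ξ₂
          - lensPrimitive a b c t (t * cos ξ₁) (t * sin ξ₁) (√((t * sin ξ₁) ^ 2 - b ^ 2)) ξ₁ := by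
      -- At `ξ₁` the square root in the primitive vanishes, so the derivative is used only in the
      -- open interval, together with continuity up to the ends.
      refine intervalIntegral.integral_eq_sub_of_hasDerivAt_of_le
        (f := fun ξ => lensPrimitive a b c t (t * cos ξ) (t * sin ξ)
          (√((t * sin ξ) ^ 2 - b ^ 2)) ξ) h12 ?_ ?_ (hi _ _)
      · have hne : ∀ ξ ∈ Icc ξ₁ ξ₂, t * cos ξ ≠ 0 := fun ξ hξ => by
          have : cos ξ₂ ≤ cos ξ := cos_le_cos_of_nonneg_of_le_pi (h0.trans hξ.1)
            (by linarith [pi_pos]) hξ.2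
          have : a ≤ t * cos ξ := by nlinarith
          linarith
        have hne' : ∀ ξ ∈ Icc ξ₁ ξ₂, b * (t * cos ξ) ≠ 0 := fun ξ hξ => mul_ne_zero hb.ne' (hne ξ hξ)
        unfold lensPrimitive
        have c1 : ContinuousOn (fun ξ => arctan (√((t * sin ξ) ^ 2 - b ^ 2) / (t * cos ξ)))
            (Icc ξ₁ ξ₂) :=
          continuous_arctan.comp_continuousOn (ContinuousOn.div (by fun_prop) (by fun_prop) hne)
        have c2 : ContinuousOn (fun ξ => arctan (t * √((t * sin ξ) ^ 2 - b ^ 2) / (b * (t * cos ξ))))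
            (Icc ξ₁ ξ₂) :=
          continuous_arctan.comp_continuousOn (ContinuousOn.div (by fun_prop) (by fun_prop) hne')
        have c3 : Continuous fun ξ => arctan (√((t * sin ξ) ^ 2 - b ^ 2) / b) := by fun_prop
        fun_prop
      · intro ξ hξ
        obtain ⟨h3, h4⟩ := hmem ξ hξ
        refine (hasDerivAt_lensPrimitive (a := a) (c := c) hb ht rfl rfl (ha.trans h3) h4
          rfl).congr_deriv ?_
        simp only [hf, hq, max_eq_left h4.le, max_eq_left (sub_nonneg.2 h3.le)]
    have hright : ∫ ξ in (0 : ℝ)..(π / 2), f ξ = ∫ ξ in (0 : ℝ)..ξ₂, f ξ := by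
      refine integral_eq_integral_of_eq_zero (h0.trans h12) h1 hfc (fun _ _ => rfl) fun ξ hξ => ?_
      have : cos ξ ≤ cos ξ₂ := cos_le_cos_of_nonneg_of_le_pi (h0.trans h12)
        (by linarith [pi_pos, hξ.2]) hξ.1
      have : t * cos ξ - a ≤ 0 := by nlinarith
      simp [hf, max_eq_right this]
    rw [hright, ← intervalIntegral.integral_add_adjacent_intervals (hi 0 ξ₁) (hi ξ₁ ξ₂), hleft,
      hmid, hcos1, hcos2, hsin1, hsin2, sub_self, sqrt_zero]
    rw [sq_sqrt (by linarith [sq_nonneg b]), zero_add]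
    exact lensPrimitive_sub_eq_tau2 c ht ht2.le

/-! ### First and second derivatives of the closed forms -/

/-- The derivative of `tau0`. -/
def tau0' (a b c t : ℝ) : ℝ :=
  8 * (-((a * b + b * c + c * a) * Real.pi / 4) + 2 * t * (a + b + c) / 3 - 3 * t ^ 2 / 8)

/-- The second derivative of `tau0`. -/
def tau0'' (a b c t : ℝ) : ℝ := 8 * (2 * (a + b + c) / 3 - 3 * t / 4)

/-- The derivative of `tau1`. -/
def tau1' (a b c t : ℝ) : ℝ :=
  8 * (b * c * Real.pi * (1 - a ^ 2 / t ^ 2) / 4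
    - (b + c) * (√(t ^ 2 - a ^ 2) * (4 - a ^ 2 / t ^ 2) / 6 - a / 2 * Real.arccos (a / t))
    + 3 * t ^ 2 / 8 - 2 * a * t / 3 + a ^ 2 / 4 + a ^ 4 / (24 * t ^ 2))

/-- The second derivative of `tau1`. -/
def tau1'' (a b c t : ℝ) : ℝ :=
  8 * (b * c * Real.pi * a ^ 2 / (2 * t ^ 3)
    - (b + c) * √(t ^ 2 - a ^ 2) * (2 * t ^ 2 + a ^ 2) / (3 * t ^ 3)
    + 3 * t / 4 - 2 * a / 3 - a ^ 4 / (12 * t ^ 3))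

/-- The derivative of `tau2`. -/
def tau2' (a b c t : ℝ) : ℝ :=
  8 * c * (√(t ^ 2 - a ^ 2 - b ^ 2) * (4 - (a ^ 2 + b ^ 2) / t ^ 2) / 6
    - a * (1 - b ^ 2 / t ^ 2) / 2 * Real.arctan (√(t ^ 2 - a ^ 2 - b ^ 2) / a)
    - b * (1 - a ^ 2 / t ^ 2) / 2 * Real.arctan (√(t ^ 2 - a ^ 2 - b ^ 2) / b))
  - 8 * (3 * t ^ 2 / 8 + (a ^ 2 + b ^ 2) / 4 + (a ^ 4 + b ^ 4 - 6 * a ^ 2 * b ^ 2) / (24 * t ^ 2)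
    - a * √(t ^ 2 - b ^ 2) * (4 - b ^ 2 / t ^ 2) / 6
    - b * √(t ^ 2 - a ^ 2) * (4 - a ^ 2 / t ^ 2) / 6
    + a * b / 2 * (Real.arccos (a / t) - Real.arcsin (b / t)))

/-- The second derivative of `tau2`. -/
def tau2'' (a b c t : ℝ) : ℝ :=
  8 * c * (√(t ^ 2 - a ^ 2 - b ^ 2) * (2 * t ^ 2 + a ^ 2 + b ^ 2) / (3 * t ^ 3)
    - a * b ^ 2 / t ^ 3 * Real.arctan (√(t ^ 2 - a ^ 2 - b ^ 2) / a)
    - a ^ 2 * b / t ^ 3 * Real.arctan (√(t ^ 2 - a ^ 2 - b ^ 2) / b))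
  - 8 * (3 * t / 4 - (a ^ 4 + b ^ 4 - 6 * a ^ 2 * b ^ 2) / (12 * t ^ 3)
    - a * √(t ^ 2 - b ^ 2) * (2 * t ^ 2 + b ^ 2) / (3 * t ^ 3)
    - b * √(t ^ 2 - a ^ 2) * (2 * t ^ 2 + a ^ 2) / (3 * t ^ 3))

theorem hasDerivAt_tau0 (a b c t : ℝ) : HasDerivAt (tau0 a b c) (tau0' a b c t) t := by
  unfold tau0 tau0'
  have hi := hasDerivAt_id t
  refine (((((hi.mul_const (a * b + b * c + c * a)).mul_const Real.pi).div_const 4).const_sub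
    (a * b * c * Real.pi / 2)).add (((hi.pow 2).mul_const (a + b + c)).div_const 3)
    |>.sub ((hi.pow 3).div_const 8) |>.const_mul 8).congr_deriv ?_
  simp

theorem hasDerivAt_tau0' (a b c t : ℝ) : HasDerivAt (tau0' a b c) (tau0'' a b c t) t := by
  unfold tau0' tau0''
  have hi := hasDerivAt_id t
  refine ((((hi.const_mul 2).mul_const (a + b + c)).div_const 3).const_add
    (-((a * b + b * c + c * a) * Real.pi / 4))
    |>.sub (((hi.pow 2).const_mul 3).div_const 8) |>.const_mul 8).congr_deriv ?_
  simp
  ring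

theorem hasDerivAt_sqrt_sq_sub {q t : ℝ} (h : q < t ^ 2) :
    HasDerivAt (fun t => √(t ^ 2 - q)) (t / √(t ^ 2 - q)) t := by
  refine (((hasDerivAt_id t).pow 2).sub_const q).sqrt (by simpa using (sub_pos.2 h).ne')
    |>.congr_deriv ?_
  simp only [Pi.pow_apply, id, Nat.cast_ofNat, Nat.reduceSub, pow_one, mul_one]
  field_simp

theorem sqrt_one_sub_div_sq {a t : ℝ} (ht : 0 < t) :
    √(1 - (a / t) ^ 2) = √(t ^ 2 - a ^ 2) / t := by
  rw [eq_div_iff ht.ne']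
  conv_lhs => rw [← Real.sqrt_sq ht.le, ← Real.sqrt_mul' _ (by positivity), Real.sqrt_sq ht.le]
  congr 1; field_simp

theorem hasDerivAt_arcsin_div {a t : ℝ} (ha : 0 < a) (h : a < t) :
    HasDerivAt (fun t => Real.arcsin (a / t)) (-(a / (t * √(t ^ 2 - a ^ 2)))) t := by
  have ht := ha.trans h
  have hu : 0 < √(t ^ 2 - a ^ 2) := Real.sqrt_pos.2 (by nlinarith)
  have h1 : a / t ≠ -1 := by have : 0 < a / t := by positivity
                             linarith
  have h2 : a / t ≠ 1 := ((div_lt_one ht).2 h).ne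
  have hd : HasDerivAt (fun t => a / t) (-(a / t ^ 2)) t := by
    refine ((hasDerivAt_inv ht.ne').const_mul a).congr_deriv ?_
    field_simp
  refine ((Real.hasDerivAt_arcsin h1 h2).comp t hd).congr_deriv ?_
  rw [sqrt_one_sub_div_sq ht]
  field_simp

theorem hasDerivAt_arccos_div {a t : ℝ} (ha : 0 < a) (h : a < t) :
    HasDerivAt (fun t => Real.arccos (a / t)) (a / (t * √(t ^ 2 - a ^ 2))) t := by
  unfold Real.arccos
  exact ((hasDerivAt_arcsin_div ha h).const_sub (Real.pi / 2)).congr_deriv (neg_neg _)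

theorem hasDerivAt_const_div_pow (k : ℝ) (n : ℕ) {t : ℝ} (ht : t ≠ 0) :
    HasDerivAt (fun t => k / t ^ n) (-(n * k / t ^ (n + 1))) t := by
  refine (((hasDerivAt_id t).pow n).inv (pow_ne_zero n ht) |>.const_mul k).congr_deriv ?_
  rcases n with _ | n
  · simp
  · simp only [id, Nat.add_sub_cancel, Pi.pow_apply]
    field_simp
    ring

theorem hasDerivAt_const_div (k : ℝ) {t : ℝ} (ht : t ≠ 0) :
    HasDerivAt (fun t => k / t) (-(k / t ^ 2)) t := by
  simpa using hasDerivAt_const_div_pow k 1 ht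

theorem hasDerivAt_tau1 {a t : ℝ} (b c : ℝ) (ha : 0 < a) (h : a < t) :
    HasDerivAt (tau1 a b c) (tau1' a b c t) t := by
  have ht := ha.trans h
  have hi := hasDerivAt_id' t
  have hd := hasDerivAt_const_div (a ^ 2) ht.ne'
  have hd4 : HasDerivAt (fun t => a ^ 4 / (24 * t)) (-(a ^ 4 / (24 * t ^ 2))) t := by
    refine ((hasDerivAt_const_div (a ^ 4) ht.ne').div_const 24).congr_deriv (by field_simp)
      |>.congr_of_eventuallyEq (Filter.Eventually.of_forall fun x => by
        simp only [div_div, mul_comm])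
  have hpos : 0 < t ^ 2 - a ^ 2 := by nlinarith
  have hu := hasDerivAt_sqrt_sq_sub (sub_pos.1 hpos)
  have hu0 : 0 < √(t ^ 2 - a ^ 2) := Real.sqrt_pos.2 hpos
  have hu2 : √(t ^ 2 - a ^ 2) ^ 2 = t ^ 2 - a ^ 2 := Real.sq_sqrt hpos.le
  have hX := hasDerivAt_arccos_div ha h
  have hA := (((hi.const_mul 2).add hd).mul hu).div_const 6 |>.sub
    (((hi.const_mul a).div_const 2).mul hX)
  replace hA := hA.congr_deriv (g' := √(t ^ 2 - a ^ 2) * (4 - a ^ 2 / t ^ 2) / 6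
      - a / 2 * Real.arccos (a / t)) (by
    simp only [Pi.add_apply]
    generalize √(t ^ 2 - a ^ 2) = u at *
    generalize Real.arccos (a / t) = X at *
    field_simp
    linear_combination (-4 * t ^ 2) * hu2)
  have hB := (((hi.sub_const (2 * a)).add hd).const_mul (b * c * Real.pi)).div_const 4
  unfold tau1 tau1'
  refine ((((((hB.sub (hA.const_mul (b + c))).add ((hi.pow 3).div_const 8)).sub
    (((hi.pow 2).const_mul a).div_const 3)).add ((hi.const_mul (a ^ 2)).div_const 4)).sub
    hd4).const_mul 8).congr_deriv ?_
  simp only [Nat.cast_ofNat, Nat.reduceSub, pow_one]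
  ring

theorem hasDerivAt_tau1' {a t : ℝ} (b c : ℝ) (ha : 0 < a) (h : a < t) :
    HasDerivAt (tau1' a b c) (tau1'' a b c t) t := by
  have ht := ha.trans h
  have hi := hasDerivAt_id' t
  have hd := hasDerivAt_const_div_pow (a ^ 2) 2 ht.ne'
  have hd4 : HasDerivAt (fun t => a ^ 4 / (24 * t ^ 2)) (-(a ^ 4 / (12 * t ^ 3))) t := by
    refine ((hasDerivAt_const_div_pow (a ^ 4) 2 ht.ne').div_const 24).congr_deriv
      (by push_cast; field_simp; norm_num)
      |>.congr_of_eventuallyEq (Filter.Eventually.of_forall fun x => by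
        simp only [div_div, mul_comm])
  have hpos : 0 < t ^ 2 - a ^ 2 := by nlinarith
  have hu := hasDerivAt_sqrt_sq_sub (sub_pos.1 hpos)
  have hu0 : 0 < √(t ^ 2 - a ^ 2) := Real.sqrt_pos.2 hpos
  have hu2 : √(t ^ 2 - a ^ 2) ^ 2 = t ^ 2 - a ^ 2 := Real.sq_sqrt hpos.le
  have hX := hasDerivAt_arccos_div ha h
  have hA := ((hu.mul (hd.const_sub 4)).div_const 6).sub (hX.const_mul (a / 2))
  replace hA := hA.congr_deriv (g' := √(t ^ 2 - a ^ 2) * (2 * t ^ 2 + a ^ 2) / (3 * t ^ 3)) (by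
    generalize √(t ^ 2 - a ^ 2) = u at *
    push_cast
    field_simp
    rw [show u ^ 2 = t ^ 2 - a ^ 2 from hu2]
    ring)
  have hB := ((hd.const_sub 1).const_mul (b * c * Real.pi)).div_const 4
  unfold tau1' tau1''
  refine ((((((hB.sub (hA.const_mul (b + c))).add (((hi.pow 2).const_mul 3).div_const 8)).sub
    ((hi.const_mul (2 * a)).div_const 3)).add_const (a ^ 2 / 4)).add
    hd4).const_mul 8).congr_deriv ?_
  simp only [Nat.cast_ofNat, Nat.reduceSub, pow_one, Nat.reduceAdd]
  ring

theorem hasDerivAt_arctan_sqrt_div {a b t : ℝ} (ha : 0 < a) (ht : 0 < t)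
    (h : a ^ 2 + b ^ 2 < t ^ 2) :
    HasDerivAt (fun t => Real.arctan (√(t ^ 2 - a ^ 2 - b ^ 2) / a))
      (a * t / (√(t ^ 2 - a ^ 2 - b ^ 2) * (t ^ 2 - b ^ 2))) t := by
  have hpos : 0 < t ^ 2 - a ^ 2 - b ^ 2 := by linarith
  have hs := hasDerivAt_sqrt_sq_sub h
  simp only [← sub_sub] at hs
  have hs2 : √(t ^ 2 - a ^ 2 - b ^ 2) ^ 2 = t ^ 2 - a ^ 2 - b ^ 2 := Real.sq_sqrt hpos.le
  have hs0 : 0 < √(t ^ 2 - a ^ 2 - b ^ 2) := Real.sqrt_pos.2 hpos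
  have hB : 0 < t ^ 2 - b ^ 2 := by nlinarith
  refine (hs.div_const a).arctan.congr_deriv ?_
  generalize √(t ^ 2 - a ^ 2 - b ^ 2) = s at *
  have : 1 + (s / a) ^ 2 = (t ^ 2 - b ^ 2) / a ^ 2 := by field_simp; linarith
  rw [this]
  field_simp

theorem hasDerivAt_arctan_mul_sqrt_div {a b t : ℝ} (ha : 0 < a) (hb : 0 < b)
    (h : a ^ 2 + b ^ 2 < t ^ 2) :
    HasDerivAt (fun t => Real.arctan (t * √(t ^ 2 - a ^ 2 - b ^ 2) / (a * b)))
      (a * b * (2 * t ^ 2 - a ^ 2 - b ^ 2) /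
        (√(t ^ 2 - a ^ 2 - b ^ 2) * (t ^ 2 - a ^ 2) * (t ^ 2 - b ^ 2))) t := by
  have hpos : 0 < t ^ 2 - a ^ 2 - b ^ 2 := by linarith
  have hs := hasDerivAt_sqrt_sq_sub h
  simp only [← sub_sub] at hs
  have hs2 : √(t ^ 2 - a ^ 2 - b ^ 2) ^ 2 = t ^ 2 - a ^ 2 - b ^ 2 := Real.sq_sqrt hpos.le
  have hs0 : 0 < √(t ^ 2 - a ^ 2 - b ^ 2) := Real.sqrt_pos.2 hpos
  have hB : 0 < t ^ 2 - b ^ 2 := by nlinarith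
  have hu : 0 < t ^ 2 - a ^ 2 := by nlinarith
  refine (((hasDerivAt_id' t).mul hs).div_const (a * b)).arctan.congr_deriv ?_
  simp only [Pi.mul_apply]
  generalize √(t ^ 2 - a ^ 2 - b ^ 2) = s at *
  have : 1 + (t * s / (a * b)) ^ 2 = (t ^ 2 - a ^ 2) * (t ^ 2 - b ^ 2) / (a * b) ^ 2 := by
    field_simp
    rw [hs2]
    ring
  rw [this]
  field_simp
  rw [hs2]
  ring

theorem hasDerivAt_arctan_sqrt_div' {a b t : ℝ} (hb : 0 < b) (ht : 0 < t)
    (h : a ^ 2 + b ^ 2 < t ^ 2) :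
    HasDerivAt (fun t => Real.arctan (√(t ^ 2 - a ^ 2 - b ^ 2) / b))
      (b * t / (√(t ^ 2 - a ^ 2 - b ^ 2) * (t ^ 2 - a ^ 2))) t := by
  have := hasDerivAt_arctan_sqrt_div (a := b) (b := a) hb ht (by linarith)
  simpa only [sub_right_comm _ (b ^ 2) (a ^ 2)] using this

/-- The coefficient of the third side length in `tau2 / 8`. -/
theorem hasDerivAt_lens_linear {a b t : ℝ} (ha : 0 < a) (hb : 0 < b) (ht : 0 < t)
    (h : a ^ 2 + b ^ 2 < t ^ 2) :
    HasDerivAt (fun t =>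
      (√(t ^ 2 - a ^ 2 - b ^ 2) ^ 3 / 3 + (a ^ 2 + b ^ 2) * √(t ^ 2 - a ^ 2 - b ^ 2) / 2) / t
      - a * (t + b ^ 2 / t) / 2 * Real.arctan (√(t ^ 2 - a ^ 2 - b ^ 2) / a)
      - b * (t + a ^ 2 / t) / 2 * Real.arctan (√(t ^ 2 - a ^ 2 - b ^ 2) / b)
      + a * b * Real.arctan (t * √(t ^ 2 - a ^ 2 - b ^ 2) / (a * b)))
      (√(t ^ 2 - a ^ 2 - b ^ 2) * (4 - (a ^ 2 + b ^ 2) / t ^ 2) / 6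
        - a * (1 - b ^ 2 / t ^ 2) / 2 * Real.arctan (√(t ^ 2 - a ^ 2 - b ^ 2) / a)
        - b * (1 - a ^ 2 / t ^ 2) / 2 * Real.arctan (√(t ^ 2 - a ^ 2 - b ^ 2) / b)) t := by
  have hpos : 0 < t ^ 2 - a ^ 2 - b ^ 2 := by linarith
  have hs := hasDerivAt_sqrt_sq_sub h
  simp only [← sub_sub] at hs
  have hs2 : √(t ^ 2 - a ^ 2 - b ^ 2) ^ 2 = t ^ 2 - a ^ 2 - b ^ 2 := Real.sq_sqrt hpos.le
  have hs0 : 0 < √(t ^ 2 - a ^ 2 - b ^ 2) := Real.sqrt_pos.2 hpos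
  have hB : 0 < t ^ 2 - b ^ 2 := by nlinarith
  have hu : 0 < t ^ 2 - a ^ 2 := by nlinarith
  have hi := hasDerivAt_id' t
  have hS := (((hs.pow 3).div_const 3).add ((hs.const_mul (a ^ 2 + b ^ 2)).div_const 2)).div hi ht.ne'
  have h1 := (((hi.add (hasDerivAt_const_div (b ^ 2) ht.ne')).const_mul a).div_const 2).mul
    (hasDerivAt_arctan_sqrt_div ha ht h)
  have h2 := (((hi.add (hasDerivAt_const_div (a ^ 2) ht.ne')).const_mul b).div_const 2).mul
    (hasDerivAt_arctan_sqrt_div' hb ht h)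
  have h3 := (hasDerivAt_arctan_mul_sqrt_div ha hb h).const_mul (a * b)
  refine (((hS.sub h1).sub h2).add h3).congr_deriv ?_
  simp only [Pi.pow_apply, Pi.add_apply, Nat.cast_ofNat, Nat.reduceSub]
  generalize Real.arctan (√(t ^ 2 - a ^ 2 - b ^ 2) / a) = A1
  generalize Real.arctan (√(t ^ 2 - a ^ 2 - b ^ 2) / b) = A2
  generalize √(t ^ 2 - a ^ 2 - b ^ 2) = s at *
  -- The derivatives of the three arctangents, with their coefficients, combine to one multiple of
  -- `1 / s`: the denominators `t² - a²` and `t² - b²` cancel. `key2` then absorbs this term into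
  -- the derivative of the algebraic part.
  have key : a * (t + b ^ 2 / t) / 2 * (a * t / (s * (t ^ 2 - b ^ 2)))
      + b * (t + a ^ 2 / t) / 2 * (b * t / (s * (t ^ 2 - a ^ 2)))
      - a * b * (a * b * (2 * t ^ 2 - a ^ 2 - b ^ 2) / (s * (t ^ 2 - a ^ 2) * (t ^ 2 - b ^ 2)))
      = (a ^ 2 + b ^ 2) / (2 * s) := by
    have hB' := hB.ne'
    have hu' := hu.ne'
    field_simp
    ring
  have key2 : ((3 * s ^ 2 * (t / s) / 3 + (a ^ 2 + b ^ 2) * (t / s) / 2) * t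
        - (s ^ 3 / 3 + (a ^ 2 + b ^ 2) * s / 2) * 1) / t ^ 2 - (a ^ 2 + b ^ 2) / (2 * s)
      = s * (4 - (a ^ 2 + b ^ 2) / t ^ 2) / 6 := by
    have hs3 : s ^ 3 = (t ^ 2 - a ^ 2 - b ^ 2) * s := by rw [← hs2]; ring
    rw [hs3]
    field_simp
    ring
  linear_combination key2 - key

theorem hasDerivAt_lens_linear' {a b t : ℝ} (ha : 0 < a) (hb : 0 < b) (ht : 0 < t)
    (h : a ^ 2 + b ^ 2 < t ^ 2) :
    HasDerivAt (fun t => √(t ^ 2 - a ^ 2 - b ^ 2) * (4 - (a ^ 2 + b ^ 2) / t ^ 2) / 6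
        - a * (1 - b ^ 2 / t ^ 2) / 2 * Real.arctan (√(t ^ 2 - a ^ 2 - b ^ 2) / a)
        - b * (1 - a ^ 2 / t ^ 2) / 2 * Real.arctan (√(t ^ 2 - a ^ 2 - b ^ 2) / b))
      (√(t ^ 2 - a ^ 2 - b ^ 2) * (2 * t ^ 2 + a ^ 2 + b ^ 2) / (3 * t ^ 3)
    - a * b ^ 2 / t ^ 3 * Real.arctan (√(t ^ 2 - a ^ 2 - b ^ 2) / a)
    - a ^ 2 * b / t ^ 3 * Real.arctan (√(t ^ 2 - a ^ 2 - b ^ 2) / b)) t := by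
  have hpos : 0 < t ^ 2 - a ^ 2 - b ^ 2 := by linarith
  have hs := hasDerivAt_sqrt_sq_sub h
  simp only [← sub_sub] at hs
  have hs2 : √(t ^ 2 - a ^ 2 - b ^ 2) ^ 2 = t ^ 2 - a ^ 2 - b ^ 2 := Real.sq_sqrt hpos.le
  have hs0 : 0 < √(t ^ 2 - a ^ 2 - b ^ 2) := Real.sqrt_pos.2 hpos
  have hB : 0 < t ^ 2 - b ^ 2 := by nlinarith
  have hu : 0 < t ^ 2 - a ^ 2 := by nlinarith
  have hS := (hs.mul ((hasDerivAt_const_div_pow (a ^ 2 + b ^ 2) 2 ht.ne').const_sub 4)).div_const 6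
  have h1 := ((((hasDerivAt_const_div_pow (b ^ 2) 2 ht.ne').const_sub 1).const_mul a).div_const
    2).mul (hasDerivAt_arctan_sqrt_div ha ht h)
  have h2 := ((((hasDerivAt_const_div_pow (a ^ 2) 2 ht.ne').const_sub 1).const_mul b).div_const
    2).mul (hasDerivAt_arctan_sqrt_div' hb ht h)
  refine ((hS.sub h1).sub h2).congr_deriv ?_
  generalize Real.arctan (√(t ^ 2 - a ^ 2 - b ^ 2) / a) = A1
  generalize Real.arctan (√(t ^ 2 - a ^ 2 - b ^ 2) / b) = A2
  generalize √(t ^ 2 - a ^ 2 - b ^ 2) = s at *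
  -- Each coefficient contains exactly the factor that cancels the denominator coming from its
  -- arctangent.
  have k1 : a * (1 - b ^ 2 / t ^ 2) / 2 * (a * t / (s * (t ^ 2 - b ^ 2))) = a ^ 2 / (2 * s * t) := by
    have hB' := hB.ne'
    field_simp
  have k2 : b * (1 - a ^ 2 / t ^ 2) / 2 * (b * t / (s * (t ^ 2 - a ^ 2))) = b ^ 2 / (2 * s * t) := by
    have hu' := hu.ne'
    field_simp
  rw [k1, k2]
  push_cast
  field_simp
  rw [hs2]
  linear_combination (-(24 * t ^ 2 + 12 * (a ^ 2 + b ^ 2))) * hs2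

/-- The part of `tau2 / 8` which does not depend on the third side length. -/
theorem hasDerivAt_lens_const {a b t : ℝ} (ha : 0 < a) (hb : 0 < b) (hat : a < t) (hbt : b < t) :
    HasDerivAt (fun t => t ^ 3 / 8 + (a ^ 2 + b ^ 2) * t / 4
        + (6 * a ^ 2 * b ^ 2 - a ^ 4 - b ^ 4) / (24 * t)
        - a * √(t ^ 2 - b ^ 2) * (2 * t + b ^ 2 / t) / 6
        - b * √(t ^ 2 - a ^ 2) * (2 * t + a ^ 2 / t) / 6
        + a * b * t / 2 * (Real.arccos (a / t) - Real.arcsin (b / t)))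
      (3 * t ^ 2 / 8 + (a ^ 2 + b ^ 2) / 4 + (a ^ 4 + b ^ 4 - 6 * a ^ 2 * b ^ 2) / (24 * t ^ 2)
        - a * √(t ^ 2 - b ^ 2) * (4 - b ^ 2 / t ^ 2) / 6
        - b * √(t ^ 2 - a ^ 2) * (4 - a ^ 2 / t ^ 2) / 6
        + a * b / 2 * (Real.arccos (a / t) - Real.arcsin (b / t))) t := by
  have ht := ha.trans hat
  have hi := hasDerivAt_id' t
  have hd4 : HasDerivAt (fun t => (6 * a ^ 2 * b ^ 2 - a ^ 4 - b ^ 4) / (24 * t))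
      (-((6 * a ^ 2 * b ^ 2 - a ^ 4 - b ^ 4) / (24 * t ^ 2))) t := by
    refine ((hasDerivAt_const_div (6 * a ^ 2 * b ^ 2 - a ^ 4 - b ^ 4) ht.ne').div_const
      24).congr_deriv (by field_simp)
      |>.congr_of_eventuallyEq (Filter.Eventually.of_forall fun x => by
        simp only [div_div, mul_comm])
  -- The singular part `3 y² / √(t² - y²)` is split off because, for `y = a` and `y = b`, it cancels
  -- against the derivatives of `arccos (a / t)` and `arcsin (b / t)`.
  have hroot : ∀ y, 0 < y → y < t → HasDerivAt (fun t => √(t ^ 2 - y ^ 2) * (2 * t + y ^ 2 / t))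
      (√(t ^ 2 - y ^ 2) * (4 - y ^ 2 / t ^ 2) + 3 * y ^ 2 / √(t ^ 2 - y ^ 2)) t := fun y hy hyt => by
    have hpos : 0 < t ^ 2 - y ^ 2 := by nlinarith
    have hu := hasDerivAt_sqrt_sq_sub (sub_pos.1 hpos)
    have hu0 : 0 < √(t ^ 2 - y ^ 2) := Real.sqrt_pos.2 hpos
    have hu2 : √(t ^ 2 - y ^ 2) ^ 2 = t ^ 2 - y ^ 2 := Real.sq_sqrt hpos.le
    refine (hu.mul ((hi.const_mul 2).add (hasDerivAt_const_div (y ^ 2) ht.ne'))).congr_deriv ?_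
    simp only [Pi.add_apply]
    generalize √(t ^ 2 - y ^ 2) = u at *
    field_simp
    rw [hu2]
    ring
  have hX := ((hi.const_mul (a * b)).div_const 2).mul
    ((hasDerivAt_arccos_div ha hat).sub (hasDerivAt_arcsin_div hb hbt))
  have := (((((hi.pow 3).div_const 8).add ((hi.const_mul (a ^ 2 + b ^ 2)).div_const 4)).add
    hd4).sub (((hroot b hb hbt).const_mul a).div_const 6)).sub
    (((hroot a ha hat).const_mul b).div_const 6) |>.add hX
  refine (this.congr_deriv ?_).congr_of_eventuallyEq (Filter.Eventually.of_forall fun x => ?_)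
  · have hu0 : 0 < √(t ^ 2 - a ^ 2) := Real.sqrt_pos.2 (by nlinarith)
    have hB0 : 0 < √(t ^ 2 - b ^ 2) := Real.sqrt_pos.2 (by nlinarith)
    simp only [Pi.sub_apply, Nat.cast_ofNat, Nat.reduceSub]
    generalize √(t ^ 2 - a ^ 2) = u at *
    generalize √(t ^ 2 - b ^ 2) = B at *
    field_simp
    ring
  · simp only [Pi.add_apply, Pi.sub_apply, Pi.mul_apply, Pi.pow_apply]
    ring

theorem hasDerivAt_lens_const' {a b t : ℝ} (ha : 0 < a) (hb : 0 < b) (hat : a < t) (hbt : b < t) :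
    HasDerivAt (fun t => 3 * t ^ 2 / 8 + (a ^ 2 + b ^ 2) / 4
        + (a ^ 4 + b ^ 4 - 6 * a ^ 2 * b ^ 2) / (24 * t ^ 2)
        - a * √(t ^ 2 - b ^ 2) * (4 - b ^ 2 / t ^ 2) / 6
        - b * √(t ^ 2 - a ^ 2) * (4 - a ^ 2 / t ^ 2) / 6
        + a * b / 2 * (Real.arccos (a / t) - Real.arcsin (b / t)))
      (3 * t / 4 - (a ^ 4 + b ^ 4 - 6 * a ^ 2 * b ^ 2) / (12 * t ^ 3)
        - a * √(t ^ 2 - b ^ 2) * (2 * t ^ 2 + b ^ 2) / (3 * t ^ 3)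
        - b * √(t ^ 2 - a ^ 2) * (2 * t ^ 2 + a ^ 2) / (3 * t ^ 3)) t := by
  have ht := ha.trans hat
  have hi := hasDerivAt_id' t
  have hd4 : HasDerivAt (fun t => (a ^ 4 + b ^ 4 - 6 * a ^ 2 * b ^ 2) / (24 * t ^ 2))
      (-((a ^ 4 + b ^ 4 - 6 * a ^ 2 * b ^ 2) / (12 * t ^ 3))) t := by
    refine ((hasDerivAt_const_div_pow (a ^ 4 + b ^ 4 - 6 * a ^ 2 * b ^ 2) 2 ht.ne').div_const
      24).congr_deriv (by push_cast; field_simp; ring)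
      |>.congr_of_eventuallyEq (Filter.Eventually.of_forall fun x => by
        simp only [div_div, mul_comm])
  have hroot : ∀ y, 0 < y → y < t → HasDerivAt (fun t => √(t ^ 2 - y ^ 2) * (4 - y ^ 2 / t ^ 2))
      (√(t ^ 2 - y ^ 2) * (4 / t + 2 * y ^ 2 / t ^ 3) + 3 * y ^ 2 / (t * √(t ^ 2 - y ^ 2))) t :=
    fun y hy hyt => by
    have hpos : 0 < t ^ 2 - y ^ 2 := by nlinarith
    have hu := hasDerivAt_sqrt_sq_sub (sub_pos.1 hpos)
    have hu0 : 0 < √(t ^ 2 - y ^ 2) := Real.sqrt_pos.2 hpos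
    have hu2 : √(t ^ 2 - y ^ 2) ^ 2 = t ^ 2 - y ^ 2 := Real.sq_sqrt hpos.le
    refine (hu.mul ((hasDerivAt_const_div_pow (y ^ 2) 2 ht.ne').const_sub 4)).congr_deriv ?_
    generalize √(t ^ 2 - y ^ 2) = u at *
    push_cast
    field_simp
    rw [hu2]
    ring
  have hX := ((hasDerivAt_arccos_div ha hat).sub (hasDerivAt_arcsin_div hb hbt)).const_mul
    (a * b / 2)
  have := ((((hi.pow 2).const_mul 3).div_const 8).add_const ((a ^ 2 + b ^ 2) / 4) |>.add
    hd4).sub (((hroot b hb hbt).const_mul a).div_const 6) |>.sub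
    (((hroot a ha hat).const_mul b).div_const 6) |>.add hX
  refine (this.congr_deriv ?_).congr_of_eventuallyEq (Filter.Eventually.of_forall fun x => ?_)
  · have hu0 : 0 < √(t ^ 2 - a ^ 2) := Real.sqrt_pos.2 (by nlinarith)
    have hB0 : 0 < √(t ^ 2 - b ^ 2) := Real.sqrt_pos.2 (by nlinarith)
    simp only [Nat.cast_ofNat, Nat.reduceSub]
    generalize √(t ^ 2 - a ^ 2) = u at *
    generalize √(t ^ 2 - b ^ 2) = B at *
    field_simp
    ring
  · simp only [Pi.add_apply, Pi.sub_apply, Pi.pow_apply]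
    ring

theorem hasDerivAt_tau2 {a b t : ℝ} (c : ℝ) (ha : 0 < a) (hb : 0 < b)
    (h : √(a ^ 2 + b ^ 2) < t) : HasDerivAt (tau2 a b c) (tau2' a b c t) t := by
  have ht : 0 < t := (Real.sqrt_nonneg _).trans_lt h
  have h2 := (Real.sqrt_lt' ht).1 h
  exact ((hasDerivAt_lens_linear ha hb ht h2).const_mul (8 * c)).sub
    ((hasDerivAt_lens_const ha hb (by nlinarith) (by nlinarith)).const_mul 8)

theorem hasDerivAt_tau2' {a b t : ℝ} (c : ℝ) (ha : 0 < a) (hb : 0 < b)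
    (h : √(a ^ 2 + b ^ 2) < t) : HasDerivAt (tau2' a b c) (tau2'' a b c t) t := by
  have ht : 0 < t := (Real.sqrt_nonneg _).trans_lt h
  have h2 := (Real.sqrt_lt' ht).1 h
  exact ((hasDerivAt_lens_linear' ha hb ht h2).const_mul (8 * c)).sub
    ((hasDerivAt_lens_const' ha hb (by nlinarith) (by nlinarith)).const_mul 8)

/-- Together with its analogue `tau2'_threshold`, this makes the terms frozen below their thresholds
continuously differentiable. Hence the tail of the chord length has no jump at a breakpoint. -/
theorem tau1'_threshold {a : ℝ} (b c : ℝ) (ha : 0 < a) : tau1' a b c a = 0 := by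
  rw [tau1', div_self ha.ne', Real.arccos_one]
  field_simp
  ring_nf
  simp

open Real in
theorem tau2'_threshold {a b : ℝ} (c : ℝ) (ha : 0 < a) (hb : 0 < b) :
    tau2' a b c √(a ^ 2 + b ^ 2) = 0 := by
  have h0 : 0 < a ^ 2 + b ^ 2 := by positivity
  set h := √(a ^ 2 + b ^ 2) with hh
  have hpos : 0 < h := sqrt_pos.2 h0
  have h2 : h ^ 2 = a ^ 2 + b ^ 2 := sq_sqrt h0.le
  have e1 : √(h ^ 2 - a ^ 2 - b ^ 2) = 0 := by rw [h2]; simp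
  have e2 : √(h ^ 2 - b ^ 2) = a := by rw [h2]; simp [ha.le]
  have e3 : √(h ^ 2 - a ^ 2) = b := by rw [h2]; simp [hb.le]
  have e4 : arccos (a / h) = arcsin (b / h) := by
    rw [arccos_eq_arcsin (by positivity)]
    congr 1
    rw [show 1 - (a / h) ^ 2 = (b / h) ^ 2 by field_simp; linarith, sqrt_sq (by positivity)]
  simp only [tau2', e1, e2, e3, e4]
  simp only [zero_div, zero_mul, mul_zero, arctan_zero, sub_self]
  rw [h2]
  field_simp
  ring

theorem continuousOn_tau1' (a b c : ℝ) : ContinuousOn (tau1' a b c) (Set.Ioi 0) := by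
  unfold tau1'
  have h1 : ContinuousOn (fun t => Real.arccos (a / t)) (Set.Ioi 0) :=
    Real.continuous_arccos.comp_continuousOn
      (continuousOn_const.div continuousOn_id fun t ht => ne_of_gt ht)
  fun_prop (disch := intro t ht; have : (0 : ℝ) < t := ht; positivity)

theorem continuousOn_tau1'' (a b c : ℝ) : ContinuousOn (tau1'' a b c) (Set.Ioi 0) := by
  unfold tau1''
  fun_prop (disch := intro t ht; have : (0 : ℝ) < t := ht; positivity)

theorem continuousOn_tau1 (a b c : ℝ) : ContinuousOn (tau1 a b c) (Set.Ioi 0) := by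
  unfold tau1
  have h1 : ContinuousOn (fun t => Real.arccos (a / t)) (Set.Ioi 0) :=
    Real.continuous_arccos.comp_continuousOn
      (continuousOn_const.div continuousOn_id fun t ht => ne_of_gt ht)
  fun_prop (disch := intro t ht; have : (0 : ℝ) < t := ht; positivity)

theorem continuousOn_tau2 (a b c : ℝ) : ContinuousOn (tau2 a b c) (Set.Ioi 0) := by
  unfold tau2
  have h1 : ContinuousOn (fun t => Real.arccos (a / t)) (Set.Ioi 0) :=
    Real.continuous_arccos.comp_continuousOn
      (continuousOn_const.div continuousOn_id fun t ht => ne_of_gt ht)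
  have h2 : ContinuousOn (fun t => Real.arcsin (b / t)) (Set.Ioi 0) :=
    Real.continuous_arcsin.comp_continuousOn
      (continuousOn_const.div continuousOn_id fun t ht => ne_of_gt ht)
  have h3 : Continuous fun t => Real.arctan (√(t ^ 2 - a ^ 2 - b ^ 2) / a) := by fun_prop
  have h4 : Continuous fun t => Real.arctan (√(t ^ 2 - a ^ 2 - b ^ 2) / b) := by fun_prop
  have h5 : Continuous fun t => Real.arctan (t * √(t ^ 2 - a ^ 2 - b ^ 2) / (a * b)) := by fun_prop
  fun_prop (disch := intro t ht; have : (0 : ℝ) < t := ht; positivity)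

theorem continuousOn_tau2' (a b c : ℝ) : ContinuousOn (tau2' a b c) (Set.Ioi 0) := by
  unfold tau2'
  have h1 : ContinuousOn (fun t => Real.arccos (a / t)) (Set.Ioi 0) :=
    Real.continuous_arccos.comp_continuousOn
      (continuousOn_const.div continuousOn_id fun t ht => ne_of_gt ht)
  have h2 : ContinuousOn (fun t => Real.arcsin (b / t)) (Set.Ioi 0) :=
    Real.continuous_arcsin.comp_continuousOn
      (continuousOn_const.div continuousOn_id fun t ht => ne_of_gt ht)
  have h3 : Continuous fun t => Real.arctan (√(t ^ 2 - a ^ 2 - b ^ 2) / a) := by fun_prop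
  have h4 : Continuous fun t => Real.arctan (√(t ^ 2 - a ^ 2 - b ^ 2) / b) := by fun_prop
  fun_prop (disch := intro t ht; have : (0 : ℝ) < t := ht; positivity)

theorem continuousOn_tau2'' (a b c : ℝ) : ContinuousOn (tau2'' a b c) (Set.Ioi 0) := by
  unfold tau2''
  have h3 : Continuous fun t => Real.arctan (√(t ^ 2 - a ^ 2 - b ^ 2) / a) := by fun_prop
  have h4 : Continuous fun t => Real.arctan (√(t ^ 2 - a ^ 2 - b ^ 2) / b) := by fun_prop
  fun_prop (disch := intro t ht; have : (0 : ℝ) < t := ht; positivity)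

/-! ### The mean excess: closed form, regularity and second derivative -/

/-- The closed form of the mean excess of the chord length of a box over `t`. -/
def excess (a b c t : ℝ) : ℝ :=
  tau0 a b c t
    + (tau1 a b c (max t a) + tau1 b c a (max t b) + tau1 c a b (max t c))
    + (tau2 a b c (max t √(a ^ 2 + b ^ 2)) + tau2 b c a (max t √(b ^ 2 + c ^ 2))
      + tau2 c a b (max t √(c ^ 2 + a ^ 2)))

/-- The derivative of `excess`. -/
def excess' (a b c t : ℝ) : ℝ :=
  tau0' a b c t
    + (tau1' a b c (max t a) + tau1' b c a (max t b) + tau1' c a b (max t c))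
    + (tau2' a b c (max t √(a ^ 2 + b ^ 2)) + tau2' b c a (max t √(b ^ 2 + c ^ 2))
      + tau2' c a b (max t √(c ^ 2 + a ^ 2)))

/-- The second derivative of `excess`, away from the breakpoints. -/
def excess'' (a b c t : ℝ) : ℝ :=
  tau0'' a b c t
    + ((if a < t then tau1'' a b c t else 0) + (if b < t then tau1'' b c a t else 0)
      + (if c < t then tau1'' c a b t else 0))
    + ((if √(a ^ 2 + b ^ 2) < t then tau2'' a b c t else 0)
      + (if √(b ^ 2 + c ^ 2) < t then tau2'' b c a t else 0)
      + (if √(c ^ 2 + a ^ 2) < t then tau2'' c a b t else 0))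

/-- The product of the positive parts of `kᵢ - t |vᵢ|`. -/
def boxOverlap (e : OrthonormalBasis (Fin 3) ℝ Space3) (a b c t : ℝ) (v : Space3) : ℝ :=
  max (a - t * |inner ℝ (e 0) v|) 0 *
    (max (b - t * |inner ℝ (e 1) v|) 0 * max (c - t * |inner ℝ (e 2) v|) 0)

theorem continuous_boxOverlap (e : OrthonormalBasis (Fin 3) ℝ Space3) (a b c t : ℝ) :
    Continuous (boxOverlap e a b c t) := by
  unfold boxOverlap
  fun_prop

theorem boxOverlap_nonneg (e : OrthonormalBasis (Fin 3) ℝ Space3) (a b c t : ℝ) (v : Space3) :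
    0 ≤ boxOverlap e a b c t v := by
  unfold boxOverlap
  positivity

theorem integrable_toSphere_of_continuous {f : Metric.sphere (0 : Space3) 1 → ℝ}
    (hf : Continuous f) : Integrable f (volume : Measure Space3).toSphere :=
  hf.integrable_of_hasCompactSupport (HasCompactSupport.of_compactSpace f)

theorem sum_sq_inner_sphere (e : OrthonormalBasis (Fin 3) ℝ Space3)
    (v : Metric.sphere (0 : Space3) 1) :
    |inner ℝ (e 0) (v : Space3)| ^ 2 + |inner ℝ (e 1) (v : Space3)| ^ 2
      + |inner ℝ (e 2) (v : Space3)| ^ 2 = 1 := by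
  have h := norm_eq_sqrt_coordTriple e (v : Space3)
  have h1 : ‖(v : Space3)‖ = 1 := by simp
  rw [h1, eq_comm, Real.sqrt_eq_one] at h
  simpa [coordTriple] using h

theorem max_sub_zero_eq (x y : ℝ) : max (x - y) 0 = (x - y) + max (y - x) 0 := by
  rcases le_total x y with h | h
  · rw [max_eq_right (by linarith), max_eq_left (by linarith)]; ring
  · rw [max_eq_left (by linarith), max_eq_right (by linarith)]; ring

/-- Expand the product after writing each factor as `x⁺ = x + (-x)⁺`: one linear term, three caps
and three intersections of two caps remain. Cyclic permutations of the basis reduce the caps and the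
intersections to one case each. -/
theorem integral_boxOverlap (e : OrthonormalBasis (Fin 3) ℝ Space3) {a b c t : ℝ}
    (ha : 0 < a) (hb : 0 < b) (hc : 0 < c) (ht : 0 < t) (hD : t ^ 2 ≤ a ^ 2 + b ^ 2 + c ^ 2) :
    ∫ v : Metric.sphere (0 : Space3) 1, boxOverlap e a b c t v
      ∂(volume : Measure Space3).toSphere = excess a b c t := by
  set e₁ := e.reindex (finRotate 3).symm with he₁
  set e₂ := e.reindex (finRotate 3) with he₂
  have h10 : e₁ 0 = e 1 := by simp [he₁]
  have h11 : e₁ 1 = e 2 := by simp [he₁]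
  have h12 : e₁ 2 = e 0 := by simp [he₁]
  have h20 : e₂ 0 = e 2 := by simp only [he₂, OrthonormalBasis.reindex_apply]; congr 1
  have h21 : e₂ 1 = e 0 := by simp only [he₂, OrthonormalBasis.reindex_apply]; congr 1
  have h22 : e₂ 2 = e 1 := by simp only [he₂, OrthonormalBasis.reindex_apply]; congr 1
  have i0 := integral_sphere_linear e a b c t
  have i1 := integral_sphere_cap e b c ha ht
  have i2 := integral_sphere_cap e₁ c a hb ht
  have i3 := integral_sphere_cap e₂ a b hc ht
  have j1 := integral_sphere_lens e c ha hb ht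
  have j2 := integral_sphere_lens e₁ a hb hc ht
  have j3 := integral_sphere_lens e₂ b hc ha ht
  rw [h10, h11, h12] at i2 j2
  rw [h20, h21, h22] at i3 j3
  rw [excess, ← i0, ← i1, ← i2, ← i3, ← j1, ← j2, ← j3]
  have hint : ∀ f : Metric.sphere (0 : Space3) 1 → ℝ, Continuous f →
    Integrable f (volume : Measure Space3).toSphere := fun f hf => integrable_toSphere_of_continuous hf
  rw [← integral_add (hint _ (by fun_prop)) (hint _ (by fun_prop)),
    ← integral_add (hint _ (by fun_prop)) (hint _ (by fun_prop)),
    ← integral_add (hint _ (by fun_prop)) (hint _ (by fun_prop)),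
    ← integral_add (hint _ (by fun_prop)) (hint _ (by fun_prop)),
    ← integral_add (hint _ (by fun_prop)) (hint _ (by fun_prop)),
    ← integral_add (hint _ (by fun_prop)) (hint _ (by fun_prop))]
  refine integral_congr_ae (Filter.Eventually.of_forall fun v => ?_)
  have hsum := sum_sq_inner_sphere e v
  simp only [boxOverlap]
  generalize |inner ℝ (e 0) (v : Space3)| = x at *
  generalize |inner ℝ (e 1) (v : Space3)| = y at *
  generalize |inner ℝ (e 2) (v : Space3)| = z at *
  -- The three caps have no common point, since one would give `t² > a² + b² + c²`. This is the only
  -- use of `hD`.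
  have hzero : max (t * x - a) 0 * max (t * y - b) 0 * max (t * z - c) 0 = 0 := by
    rcases le_or_gt (t * x) a with h1 | h1
    · rw [max_eq_right (by linarith : t * x - a ≤ 0)]; ring
    rcases le_or_gt (t * y) b with h2 | h2
    · rw [max_eq_right (by linarith : t * y - b ≤ 0)]; ring
    rcases le_or_gt (t * z) c with h3 | h3
    · rw [max_eq_right (by linarith : t * z - c ≤ 0)]; ring
    exfalso
    have e1 : a ^ 2 < (t * x) ^ 2 := by gcongr
    have e2 : b ^ 2 < (t * y) ^ 2 := by gcongr
    have e3 : c ^ 2 < (t * z) ^ 2 := by gcongr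
    have : (t * x) ^ 2 + (t * y) ^ 2 + (t * z) ^ 2 = t ^ 2 := by
      linear_combination t ^ 2 * hsum
    linarith
  rw [max_sub_zero_eq a, max_sub_zero_eq b, max_sub_zero_eq c]
  linear_combination hzero

/-- A function glued to zero at a threshold. -/
theorem hasDerivAt_comp_max {f f' : ℝ → ℝ} {h : ℝ} (hh : 0 < h)
    (hf : ContinuousOn f (Set.Ioi 0)) (hf' : ContinuousOn f' (Set.Ioi 0)) (h0' : f' h = 0)
    (hd : ∀ t, h < t → HasDerivAt f (f' t) t) (t : ℝ) :
    HasDerivAt (fun t => f (max t h)) (f' (max t h)) t := by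
  have hmax : Continuous fun t : ℝ => max t h := by fun_prop
  have hpos : ∀ t, max t h ∈ Set.Ioi (0 : ℝ) := fun t => hh.trans_le (le_max_right _ _)
  have hc : Continuous fun t => f (max t h) := hf.comp_continuous hmax hpos
  have hc' : Continuous fun t => f' (max t h) := hf'.comp_continuous hmax hpos
  have hne : ∀ y, y ≠ h → HasDerivAt (fun t => f (max t h)) (f' (max y h)) y := fun y hy => by
    rcases lt_or_gt_of_ne hy with hy | hy
    · rw [max_eq_right hy.le, h0']
      refine (hasDerivAt_const y (f h)).congr_of_eventuallyEq ?_
      filter_upwards [Iio_mem_nhds hy] with z hz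
      rw [max_eq_right (le_of_lt hz)]
    · rw [max_eq_left hy.le]
      refine (hd y hy).congr_of_eventuallyEq ?_
      filter_upwards [Ioi_mem_nhds hy] with z hz
      rw [max_eq_left (le_of_lt hz)]
  rcases eq_or_ne t h with rfl | hth
  -- At the threshold the derivative is obtained as the limit of the derivatives at nearby points.
  · exact hasDerivAt_of_hasDerivAt_of_ne hne hc.continuousAt hc'.continuousAt
  · exact hne t hth

/-- The threshold has to be excluded when this is applied to first derivatives: `tau1''` equals `4 π
b c / a` at `a`, so the second derivative jumps there. -/
theorem hasDerivAt_comp_max_of_ne {f f' : ℝ → ℝ} {h t : ℝ}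
    (hd : ∀ t, h < t → HasDerivAt f (f' t) t) (ht : t ≠ h) :
    HasDerivAt (fun t => f (max t h)) (if h < t then f' t else 0) t := by
  rcases lt_or_gt_of_ne ht with hy | hy
  · rw [if_neg (not_lt.2 hy.le)]
    refine (hasDerivAt_const t (f h)).congr_of_eventuallyEq ?_
    filter_upwards [Iio_mem_nhds hy] with z hz
    rw [max_eq_right (le_of_lt hz)]
  · rw [if_pos hy]
    refine (hd t hy).congr_of_eventuallyEq ?_
    filter_upwards [Ioi_mem_nhds hy] with z hz
    rw [max_eq_left (le_of_lt hz)]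

theorem hasDerivAt_tau1_max {a : ℝ} (b c : ℝ) (ha : 0 < a) (t : ℝ) :
    HasDerivAt (fun t => tau1 a b c (max t a)) (tau1' a b c (max t a)) t :=
  hasDerivAt_comp_max ha (continuousOn_tau1 a b c) (continuousOn_tau1' a b c)
    (tau1'_threshold b c ha) (fun _ h => hasDerivAt_tau1 b c ha h) t

theorem hasDerivAt_tau2_max {a b : ℝ} (c : ℝ) (ha : 0 < a) (hb : 0 < b) (t : ℝ) :
    HasDerivAt (fun t => tau2 a b c (max t √(a ^ 2 + b ^ 2)))
      (tau2' a b c (max t √(a ^ 2 + b ^ 2))) t :=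
  hasDerivAt_comp_max (Real.sqrt_pos.2 (by positivity)) (continuousOn_tau2 a b c)
    (continuousOn_tau2' a b c) (tau2'_threshold c ha hb) (fun _ h => hasDerivAt_tau2 c ha hb h) t

theorem hasDerivAt_excess {a b c : ℝ} (ha : 0 < a) (hb : 0 < b) (hc : 0 < c) (t : ℝ) :
    HasDerivAt (excess a b c) (excess' a b c t) t :=
  ((hasDerivAt_tau0 a b c t).add (((hasDerivAt_tau1_max b c ha t).add
    (hasDerivAt_tau1_max c a hb t)).add (hasDerivAt_tau1_max a b hc t))).add
    (((hasDerivAt_tau2_max c ha hb t).add (hasDerivAt_tau2_max a hb hc t)).add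
      (hasDerivAt_tau2_max b hc ha t))

/-- The points at which the density changes its analytic form. -/
def breakpoints (a b c : ℝ) : Set ℝ :=
  {a, b, c, √(a ^ 2 + b ^ 2), √(b ^ 2 + c ^ 2), √(c ^ 2 + a ^ 2)}

theorem countable_breakpoints (a b c : ℝ) : (breakpoints a b c).Countable :=
  Set.Finite.countable (by simp [breakpoints])

theorem hasDerivAt_excess' {a b c t : ℝ} (ha : 0 < a) (hb : 0 < b) (hc : 0 < c)
    (ht : t ∉ breakpoints a b c) : HasDerivAt (excess' a b c) (excess'' a b c t) t := by
  simp only [breakpoints, Set.mem_insert_iff, Set.mem_singleton_iff, not_or] at ht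
  obtain ⟨h1, h2, h3, h4, h5, h6⟩ := ht
  exact ((hasDerivAt_tau0' a b c t).add
    (((hasDerivAt_comp_max_of_ne (fun _ h => hasDerivAt_tau1' b c ha h) h1).add
    (hasDerivAt_comp_max_of_ne (fun _ h => hasDerivAt_tau1' c a hb h) h2)).add
    (hasDerivAt_comp_max_of_ne (fun _ h => hasDerivAt_tau1' a b hc h) h3))).add
    (((hasDerivAt_comp_max_of_ne (fun _ h => hasDerivAt_tau2' c ha hb h) h4).add
    (hasDerivAt_comp_max_of_ne (fun _ h => hasDerivAt_tau2' a hb hc h) h5)).add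
    (hasDerivAt_comp_max_of_ne (fun _ h => hasDerivAt_tau2' b hc ha h) h6))

theorem continuous_excess' {a b c : ℝ} (ha : 0 < a) (hb : 0 < b) (hc : 0 < c) :
    Continuous (excess' a b c) := by
  have k1 : ∀ {a : ℝ} (b c : ℝ), 0 < a → Continuous fun t => tau1' a b c (max t a) :=
    fun {a} b c ha => (continuousOn_tau1' a b c).comp_continuous (by fun_prop)
      fun t => ha.trans_le (le_max_right _ _)
  have k2 : ∀ {a b : ℝ} (c : ℝ), 0 < a → 0 < b →
      Continuous fun t => tau2' a b c (max t √(a ^ 2 + b ^ 2)) :=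
    fun {a b} c ha hb => (continuousOn_tau2' a b c).comp_continuous (by fun_prop)
      fun t => (Real.sqrt_pos.2 (by positivity)).trans_le (le_max_right t _)
  have k0 : Continuous (tau0' a b c) := by unfold tau0'; fun_prop
  unfold excess'
  exact (k0.add (((k1 b c ha).add (k1 c a hb)).add (k1 a b hc))).add
    (((k2 c ha hb).add (k2 a hb hc)).add (k2 b hc ha))

theorem intervalIntegrable_ite_lt {f : ℝ → ℝ} {h : ℝ} (hh : 0 < h)
    (hf : ContinuousOn f (Set.Ioi 0)) {x y : ℝ} (hxy : x ≤ y) :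
    IntervalIntegrable (fun t => if h < t then f t else 0) volume x y := by
  have h1 : IntegrableOn f (Set.Icc h y) :=
    (hf.mono fun z hz => hh.trans_le hz.1).integrableOn_Icc
  rw [intervalIntegrable_iff_integrableOn_Ioc_of_le hxy]
  have : (fun t => if h < t then f t else 0) = (Set.Ioi h).indicator f := by
    ext t; simp [Set.indicator_apply]
  rw [this, IntegrableOn, integrable_indicator_iff measurableSet_Ioi, IntegrableOn,
    Measure.restrict_restrict measurableSet_Ioi]
  exact h1.mono_set fun z hz => ⟨le_of_lt hz.1, hz.2.2⟩

theorem intervalIntegrable_excess'' {a b c : ℝ} (ha : 0 < a) (hb : 0 < b) (hc : 0 < c)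
    {x y : ℝ} (hxy : x ≤ y) : IntervalIntegrable (excess'' a b c) volume x y := by
  have k1 : ∀ {a : ℝ} (b c : ℝ), 0 < a → _ := fun {a} b c ha =>
    intervalIntegrable_ite_lt ha (continuousOn_tau1'' a b c) hxy
  have k2 : ∀ {a b : ℝ} (c : ℝ), 0 < a → 0 < b → _ := fun {a b} c ha hb =>
    intervalIntegrable_ite_lt (h := √(a ^ 2 + b ^ 2)) (Real.sqrt_pos.2 (by positivity))
      (continuousOn_tau2'' a b c) hxy
  have k0 : Continuous (tau0'' a b c) := by unfold tau0''; fun_prop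
  exact ((k0.intervalIntegrable x y).add (((k1 b c ha).add (k1 c a hb)).add (k1 a b hc))).add
    (((k2 c ha hb).add (k2 a hb hc)).add (k2 b hc ha))

/-- The jumps are harmless: `excess'` is continuous, and differentiable off a finite set. -/
theorem integral_excess'' {a b c : ℝ} (ha : 0 < a) (hb : 0 < b) (hc : 0 < c)
    {x y : ℝ} (hxy : x ≤ y) :
    ∫ t in x..y, excess'' a b c t = excess' a b c y - excess' a b c x :=
  integral_eq_of_hasDerivAt_off_countable_of_le _ _ hxy
    (countable_breakpoints a b c) (continuous_excess' ha hb hc).continuousOn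
    (fun _ ht => hasDerivAt_excess' ha hb hc ht.2) (intervalIntegrable_excess'' ha hb hc hxy)

/-- All cap terms are frozen at their thresholds, so only `tau0'` contributes. Up to sign the value
is `π` times the surface area, as in Cauchy's formula for the measure of the directed lines meeting
a convex body. -/
theorem excess'_zero {a b c : ℝ} (ha : 0 < a) (hb : 0 < b) (hc : 0 < c) :
    excess' a b c 0 = -(2 * Real.pi * (a * b + a * c + b * c)) := by
  simp only [excess', max_eq_right ha.le, max_eq_right hb.le, max_eq_right hc.le,
    max_eq_right (Real.sqrt_nonneg _), tau1'_threshold _ _ ha, tau1'_threshold _ _ hb,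
    tau1'_threshold _ _ hc, tau2'_threshold _ ha hb, tau2'_threshold _ hb hc,
    tau2'_threshold _ hc ha, tau0']
  ring

/-- The second derivative splits into three cyclic shares. The share of `F(a, b, c, t)` consists of
`16 a / 3 - 2 t` from `tau0''`, the cap belonging to `a`, and the intersection of the caps belonging
to `a` and `b`; the branches of `F` record which of these have set in. -/
theorem boxF_eq {a b t : ℝ} (c : ℝ) (ha : 0 < a) (ht : 0 < t)
    (hta : t ≠ a) (htab : t ≠ √(a ^ 2 + b ^ 2)) :
    2 * boxF a b c t / (3 * t ^ 3)
      = (16 * a / 3 - 2 * t) + (if a < t then tau1'' a b c t else 0)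
        + (if √(a ^ 2 + b ^ 2) < t then tau2'' a b c t else 0) := by
  have hab : a ≤ √(a ^ 2 + b ^ 2) := Real.le_sqrt_of_sq_le (by nlinarith [sq_nonneg b])
  unfold boxF
  rcases lt_or_gt_of_ne hta with h1 | h1
  · rw [if_pos h1, if_neg (not_lt.2 h1.le), if_neg (not_lt.2 (h1.le.trans hab))]
    field_simp
    ring
  · rw [if_neg (not_lt.2 h1.le), if_pos h1]
    have hu : |t ^ 2 - a ^ 2| = t ^ 2 - a ^ 2 := abs_of_pos (by nlinarith)
    rcases lt_or_gt_of_ne htab with h2 | h2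
    · rw [if_pos h2, if_neg (not_lt.2 h2.le), hu, tau1'']
      field_simp
      ring
    · rw [if_neg (not_lt.2 h2.le), if_pos h2]
      have h3 := (Real.sqrt_lt' ht).1 h2
      have hB : |t ^ 2 - b ^ 2| = t ^ 2 - b ^ 2 := abs_of_pos (by nlinarith)
      have hs : |t ^ 2 - a ^ 2 - b ^ 2| = t ^ 2 - a ^ 2 - b ^ 2 := abs_of_pos (by nlinarith)
      rw [hu, hB, hs, tau1'', tau2'']
      generalize Real.arctan (√(t ^ 2 - a ^ 2 - b ^ 2) / a) = A1
      generalize Real.arctan (√(t ^ 2 - a ^ 2 - b ^ 2) / b) = A2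
      generalize √(t ^ 2 - a ^ 2) = u
      generalize √(t ^ 2 - b ^ 2) = B
      generalize √(t ^ 2 - a ^ 2 - b ^ 2) = s
      field_simp
      ring

theorem excess''_eq_boxF {a b c t : ℝ} (ha : 0 < a) (hb : 0 < b) (hc : 0 < c) (ht : 0 < t)
    (h : t ∉ breakpoints a b c) :
    excess'' a b c t = 2 * (boxF a b c t + boxF b c a t + boxF c a b t) / (3 * t ^ 3) := by
  simp only [breakpoints, Set.mem_insert_iff, Set.mem_singleton_iff, not_or] at h
  obtain ⟨h1, h2, h3, h4, h5, h6⟩ := h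
  have e1 := boxF_eq c ha ht h1 h4
  have e2 := boxF_eq a hb ht h2 h5
  have e3 := boxF_eq b hc ht h3 h6
  rw [mul_add, mul_add, add_div, add_div, e1, e2, e3, excess'', tau0'']
  ring

/-! ### Behaviour at the diagonal -/

/-- Where the overlap is nonzero, `(t |vᵢ|)² ≤ kᵢ²` for all `i` and these squares add up to `t²`.
Each gap `kᵢ² - (t |vᵢ|)²` is therefore at most `δ = a² + b² + c² - t²`, so `kᵢ - t |vᵢ| ≤ δ / kᵢ`.
Estimating two factors this way gives order two, which is enough for the mean excess and its
derivative to vanish at the diagonal. -/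
theorem boxOverlap_le (e : OrthonormalBasis (Fin 3) ℝ Space3) {a b c t : ℝ}
    (ha : 0 < a) (hb : 0 < b) (hc : 0 < c) (ht : 0 ≤ t) (hD : t ^ 2 ≤ a ^ 2 + b ^ 2 + c ^ 2)
    (v : Metric.sphere (0 : Space3) 1) :
    boxOverlap e a b c t v ≤ c / (a * b) * (a ^ 2 + b ^ 2 + c ^ 2 - t ^ 2) ^ 2 := by
  have hsum := sum_sq_inner_sphere e v
  have hx := abs_nonneg (inner ℝ (e 0) (v : Space3))
  have hy := abs_nonneg (inner ℝ (e 1) (v : Space3))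
  have hz := abs_nonneg (inner ℝ (e 2) (v : Space3))
  simp only [boxOverlap]
  generalize |inner ℝ (e 0) (v : Space3)| = x at *
  generalize |inner ℝ (e 1) (v : Space3)| = y at *
  generalize |inner ℝ (e 2) (v : Space3)| = z at *
  have hR : 0 ≤ c / (a * b) * (a ^ 2 + b ^ 2 + c ^ 2 - t ^ 2) ^ 2 := by positivity
  rcases le_or_gt a (t * x) with h1 | h1
  · rw [max_eq_right (by linarith : a - t * x ≤ 0), zero_mul]; exact hR
  rcases le_or_gt b (t * y) with h2 | h2
  · rw [max_eq_right (by linarith : b - t * y ≤ 0), zero_mul, mul_zero]; exact hR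
  rcases le_or_gt c (t * z) with h3 | h3
  · rw [max_eq_right (by linarith : c - t * z ≤ 0), mul_zero, mul_zero]; exact hR
  rw [max_eq_left (by linarith), max_eq_left (by linarith), max_eq_left (by linarith)]
  have htx : 0 ≤ t * x := by positivity
  have hty : 0 ≤ t * y := by positivity
  have htz : 0 ≤ t * z := by positivity
  have hs : (t * x) ^ 2 + (t * y) ^ 2 + (t * z) ^ 2 = t ^ 2 := by linear_combination t ^ 2 * hsum
  have e1 : (t * x) ^ 2 ≤ a ^ 2 := by gcongr
  have e2 : (t * y) ^ 2 ≤ b ^ 2 := by gcongr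
  have e3 : (t * z) ^ 2 ≤ c ^ 2 := by gcongr
  set δ := a ^ 2 + b ^ 2 + c ^ 2 - t ^ 2 with hδ
  have k1 : a - t * x ≤ δ / a := by
    rw [le_div_iff₀ ha]; nlinarith
  have k2 : b - t * y ≤ δ / b := by
    rw [le_div_iff₀ hb]; nlinarith
  have k3 : c - t * z ≤ c := by linarith
  calc (a - t * x) * ((b - t * y) * (c - t * z)) ≤ δ / a * (δ / b * c) := by
        have hδ0 : 0 ≤ δ := by linarith
        have : 0 ≤ δ / a := by positivity
        have : 0 ≤ δ / b := by positivity
        gcongr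
    _ = c / (a * b) * δ ^ 2 := by field_simp

theorem excess_nonneg {a b c t : ℝ} (ha : 0 < a) (hb : 0 < b) (hc : 0 < c) (ht : 0 < t)
    (hD : t ^ 2 ≤ a ^ 2 + b ^ 2 + c ^ 2) : 0 ≤ excess a b c t := by
  rw [← integral_boxOverlap (EuclideanSpace.basisFun (Fin 3) ℝ) ha hb hc ht hD]
  exact integral_nonneg fun v => boxOverlap_nonneg _ _ _ _ _ _

theorem exists_excess_le {a b c : ℝ} (ha : 0 < a) (hb : 0 < b) (hc : 0 < c) :
    ∃ C, 0 ≤ C ∧ ∀ t, 0 < t → t ^ 2 ≤ a ^ 2 + b ^ 2 + c ^ 2 →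
      excess a b c t ≤ C * (a ^ 2 + b ^ 2 + c ^ 2 - t ^ 2) ^ 2 := by
  refine ⟨(volume : Measure Space3).toSphere.real Set.univ * (c / (a * b)), by positivity,
    fun t ht hD => ?_⟩
  set e := EuclideanSpace.basisFun (Fin 3) ℝ
  rw [← integral_boxOverlap e ha hb hc ht hD, mul_assoc]
  refine (integral_mono (integrable_toSphere_of_continuous
    ((continuous_boxOverlap e a b c t).comp continuous_subtype_val)) (integrable_const _)
    (boxOverlap_le e ha hb hc ht.le hD)).trans ?_
  rw [integral_const, smul_eq_mul]

theorem excess_diagonal {a b c : ℝ} (ha : 0 < a) (hb : 0 < b) (hc : 0 < c) :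
    excess a b c √(a ^ 2 + b ^ 2 + c ^ 2) = 0 := by
  have h0 : 0 < a ^ 2 + b ^ 2 + c ^ 2 := by positivity
  have h2 := Real.sq_sqrt h0.le
  obtain ⟨C, _, hC⟩ := exists_excess_le ha hb hc
  refine le_antisymm ?_ (excess_nonneg ha hb hc (Real.sqrt_pos.2 h0) h2.le)
  simpa [h2] using hC _ (Real.sqrt_pos.2 h0) h2.le

-- The closed form is differentiable at the diagonal but is a mean excess only up to it. So the
-- derivative is computed from left slopes, which the quadratic bound forces to zero.
open Filter Topology in
theorem excess'_diagonal {a b c : ℝ} (ha : 0 < a) (hb : 0 < b) (hc : 0 < c) :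
    excess' a b c √(a ^ 2 + b ^ 2 + c ^ 2) = 0 := by
  have h0 : 0 < a ^ 2 + b ^ 2 + c ^ 2 := by positivity
  have h2 := Real.sq_sqrt h0.le
  have hz := excess_diagonal ha hb hc
  obtain ⟨C, hC0, hC⟩ := exists_excess_le ha hb hc
  set D := √(a ^ 2 + b ^ 2 + c ^ 2) with hD
  have hDpos : 0 < D := Real.sqrt_pos.2 h0
  have hl := (hasDerivAt_excess ha hb hc D).tendsto_slope_zero_left
  refine tendsto_nhds_unique hl (squeeze_zero_norm' (a := fun x => C * (2 * D) ^ 2 * |x|) ?_ ?_)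
  · filter_upwards [Ioo_mem_nhdsLT (neg_lt_zero.2 hDpos)] with x hx
    have hle : (D + x) ^ 2 ≤ a ^ 2 + b ^ 2 + c ^ 2 := by
      rw [← h2]; nlinarith [hx.1, hx.2]
    have k1 := excess_nonneg ha hb hc (t := D + x) (by linarith [hx.1]) hle
    have k2 := hC (D + x) (by linarith [hx.1]) hle
    have hxa : |x| = -x := abs_of_neg hx.2
    rw [hz, sub_zero, smul_eq_mul, norm_mul, norm_inv, Real.norm_eq_abs, Real.norm_eq_abs,
      abs_of_nonneg k1, hxa, inv_mul_le_iff₀ (by linarith [hx.2])]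
    refine k2.trans ?_
    rw [← h2]
    have : (D ^ 2 - (D + x) ^ 2) ^ 2 = (2 * D + x) ^ 2 * (-x) ^ 2 := by ring
    rw [this]
    have : (2 * D + x) ^ 2 ≤ (2 * D) ^ 2 := by
      have := hx.1
      have := hx.2
      gcongr <;> linarith
    calc C * ((2 * D + x) ^ 2 * (-x) ^ 2) ≤ C * ((2 * D) ^ 2 * (-x) ^ 2) := by gcongr
      _ = _ := by ring
  · have : Tendsto (fun x : ℝ => C * (2 * D) ^ 2 * |x|) (𝓝 0) (𝓝 (C * (2 * D) ^ 2 * |0|)) :=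
      Continuous.tendsto (by fun_prop) 0
    simp only [abs_zero, mul_zero] at this
    exact this.mono_left nhdsWithin_le_nhds

/-! ### Tails as derivatives of the mean excess -/

section

open Filter Topology

variable {Ω : Type*} [MeasurableSpace Ω] {μ : Measure Ω} {X : Ω → ℝ}

/-- Holds pointwise: lowering the level from `t` to `s` adds the full `t - s` wherever `X > t`. With
the companion bound `lintegral_excess_le_add`, it encloses the slope of the mean excess between two
tails. -/
theorem lintegral_excess_add_le (hX : Measurable X) {s t : ℝ} (hst : s ≤ t) :
    ∫⁻ ω, ENNReal.ofReal (X ω - t) ∂μ + ENNReal.ofReal (t - s) * μ {ω | t < X ω}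
      ≤ ∫⁻ ω, ENNReal.ofReal (X ω - s) ∂μ := by
  have hm : MeasurableSet {ω | t < X ω} := measurableSet_lt measurable_const hX
  rw [← lintegral_indicator_const hm, ← lintegral_add_left (by fun_prop)]
  refine lintegral_mono fun ω => ?_
  by_cases h : t < X ω
  · simp only [Set.indicator_of_mem (show ω ∈ {ω | t < X ω} from h)]
    rw [← ENNReal.ofReal_add (by linarith) (by linarith)]
    exact ENNReal.ofReal_le_ofReal (by linarith)
  · simp only [Set.indicator_of_notMem (show ω ∉ {ω | t < X ω} from h), add_zero]
    exact ENNReal.ofReal_le_ofReal (by linarith)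

theorem lintegral_excess_le_add (hX : Measurable X) {s t : ℝ} (hst : s ≤ t) :
    ∫⁻ ω, ENNReal.ofReal (X ω - s) ∂μ
      ≤ ∫⁻ ω, ENNReal.ofReal (X ω - t) ∂μ + ENNReal.ofReal (t - s) * μ {ω | s < X ω} := by
  have hm : MeasurableSet {ω | s < X ω} := measurableSet_lt measurable_const hX
  rw [← lintegral_indicator_const hm, ← lintegral_add_left (by fun_prop)]
  refine lintegral_mono fun ω => ?_
  by_cases h : s < X ω
  · simp only [Set.indicator_of_mem (show ω ∈ {ω | s < X ω} from h)]
    rcases le_total (X ω) t with h1 | h1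
    · exact (ENNReal.ofReal_le_ofReal (by linarith)).trans le_add_self
    · rw [← ENNReal.ofReal_add (by linarith) (by linarith)]
      exact ENNReal.ofReal_le_ofReal (by linarith)
  · rw [ENNReal.ofReal_of_nonpos (by linarith : X ω - s ≤ 0)]
    exact zero_le

/-- The tail of a random variable is minus the derivative of its mean excess function. -/
theorem measure_lt_eq_of_hasDerivAt (hX : Measurable X) {H : ℝ → ℝ} {H' t : ℝ}
    (hH : ∀ᶠ s in 𝓝 t, ∫⁻ ω, ENNReal.ofReal (X ω - s) ∂μ = ENNReal.ofReal (H s) ∧ 0 ≤ H s)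
    (hd : HasDerivAt H H' t) :
    μ {ω | t < X ω} = ENNReal.ofReal (-H') ∧ 0 ≤ -H' := by
  obtain ⟨ε, hε, hball⟩ := Metric.eventually_nhds_iff.1 hH
  have hHs : ∀ s, |s - t| < ε →
      ∫⁻ ω, ENNReal.ofReal (X ω - s) ∂μ = ENNReal.ofReal (H s) ∧ 0 ≤ H s := fun s hs =>
    hball (by rwa [Real.dist_eq])
  obtain ⟨ht1, ht2⟩ := hHs t (by simpa using hε)
  have hleft : ∀ δ, 0 < δ → δ < ε →
      ENNReal.ofReal (H t) + ENNReal.ofReal δ * μ {ω | t < X ω} ≤ ENNReal.ofReal (H (t - δ)) :=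
    fun δ h0 h1 => by
      have := lintegral_excess_add_le (μ := μ) hX (s := t - δ) (t := t) (by linarith)
      rw [ht1, (hHs (t - δ) (by simpa [abs_of_pos h0] using h1)).1, sub_sub_cancel] at this
      exact this
  -- The measure may be infinite; finiteness of the tail comes from finiteness of the mean excess at
  -- a slightly lower level.
  have hfin : μ {ω | t < X ω} ≠ ⊤ := fun htop => by
    have := hleft (ε / 2) (by positivity) (by linarith)
    rw [htop, ENNReal.mul_top (by simp [hε]), add_top, top_le_iff] at this
    exact ENNReal.ofReal_ne_top this
  set m := (μ {ω | t < X ω}).toReal with hm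
  have hm0 : 0 ≤ m := ENNReal.toReal_nonneg
  have hmeq : μ {ω | t < X ω} = ENNReal.ofReal m := (ENNReal.ofReal_toReal hfin).symm
  suffices h : m = -H' by rw [hmeq, ← h]; exact ⟨rfl, hm0⟩
  apply le_antisymm
  -- Left slopes are at most `-m` and right slopes at least `-m`; differentiability makes both
  -- limits equal.
  · have hl := hd.tendsto_slope_zero_left
    have : H' ≤ -m := by
      refine le_of_tendsto hl ?_
      filter_upwards [Ioo_mem_nhdsLT (neg_lt_zero.2 hε)] with x hx
      have := hleft (-x) (by linarith [hx.2]) (by linarith [hx.1])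
      rw [hmeq, ← ENNReal.ofReal_mul (by linarith [hx.2]),
        ← ENNReal.ofReal_add ht2 (mul_nonneg (by linarith [hx.2]) hm0), sub_neg_eq_add,
        ENNReal.ofReal_le_ofReal_iff (hHs (t + x) (by
          simpa [abs_of_neg hx.2] using (neg_lt.1 hx.1))).2] at this
      rw [smul_eq_mul, ← div_eq_inv_mul, div_le_iff_of_neg hx.2]
      linarith
    linarith
  · have hr := hd.tendsto_slope_zero_right
    have : -m ≤ H' := by
      refine ge_of_tendsto hr ?_
      filter_upwards [Ioo_mem_nhdsGT hε] with x hx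
      have hHx := hHs (t + x) (by simpa [abs_of_pos hx.1] using hx.2)
      have := lintegral_excess_le_add (μ := μ) hX (s := t) (t := t + x) (by linarith [hx.1])
      rw [ht1, hHx.1, add_sub_cancel_left, hmeq, ← ENNReal.ofReal_mul hx.1.le,
        ← ENNReal.ofReal_add hHx.2 (mul_nonneg hx.1.le hm0),
        ENNReal.ofReal_le_ofReal_iff (add_nonneg hHx.2 (mul_nonneg hx.1.le hm0))] at this
      rw [smul_eq_mul, le_inv_mul_iff₀ hx.1]
      linarith
    linarith

end

theorem lintegral_chordLength_sub_eq_excess (e : OrthonormalBasis (Fin 3) ℝ Space3) (p : Space3)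
    {a b c t : ℝ} (ha : 0 < a) (hb : 0 < b) (hc : 0 < c) (ht : 0 < t)
    (hD : t ^ 2 ≤ a ^ 2 + b ^ 2 + c ^ 2) :
    ∫⁻ l, ENNReal.ofReal (chordLength (box e p a b c) l - t) ∂lineMeasure
      = ENNReal.ofReal (excess a b c t) := by
  rw [lintegral_chordLength_sub e p a b c ht.le, ← integral_boxOverlap e ha hb hc ht hD,
    ofReal_integral_eq_lintegral_ofReal (f := fun v : Metric.sphere (0 : Space3) 1 =>
      boxOverlap e a b c t v) (integrable_toSphere_of_continuous
      ((continuous_boxOverlap e a b c t).comp continuous_subtype_val))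
      (Filter.Eventually.of_forall fun v => boxOverlap_nonneg _ _ _ _ _ _)]
  refine lintegral_congr fun v => ?_
  have hmax : ∀ x : ℝ, ENNReal.ofReal (max x 0) = ENNReal.ofReal x := fun x => by
    rcases le_total x 0 with h | h
    · rw [max_eq_right h, ENNReal.ofReal_zero, ENNReal.ofReal_of_nonpos h]
    · rw [max_eq_left h]
  rw [boxOverlap, ENNReal.ofReal_mul (le_max_right _ _), ENNReal.ofReal_mul (le_max_right _ _),
    hmax, hmax, hmax, Fin.prod_univ_three, mul_assoc]
  rfl

theorem lineMeasure_lt_chordLength (e : OrthonormalBasis (Fin 3) ℝ Space3) (p : Space3)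
    {a b c t : ℝ} (ha : 0 < a) (hb : 0 < b) (hc : 0 < c) (ht : 0 < t)
    (hD : t < √(a ^ 2 + b ^ 2 + c ^ 2)) :
    lineMeasure {l | t < chordLength (box e p a b c) l} = ENNReal.ofReal (-excess' a b c t)
      ∧ 0 ≤ -excess' a b c t := by
  refine measure_lt_eq_of_hasDerivAt
    (measurable_chordLength (isCompact_box e p a b c).measurableSet) ?_
    (hasDerivAt_excess ha hb hc t)
  filter_upwards [Ioo_mem_nhds ht hD] with s hs
  have h2 := ((Real.lt_sqrt hs.1.le).1 hs.2).le
  exact ⟨lintegral_chordLength_sub_eq_excess e p ha hb hc hs.1 h2, excess_nonneg ha hb hc hs.1 h2⟩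

/-- The mean excess over the diagonal is zero, so almost no line has a longer chord. -/
theorem lineMeasure_diagonal_lt_chordLength (e : OrthonormalBasis (Fin 3) ℝ Space3) (p : Space3)
    {a b c t : ℝ} (ha : 0 < a) (hb : 0 < b) (hc : 0 < c) (hD : √(a ^ 2 + b ^ 2 + c ^ 2) ≤ t) :
    lineMeasure {l | t < chordLength (box e p a b c) l} = 0 := by
  have h0 : 0 < a ^ 2 + b ^ 2 + c ^ 2 := by positivity
  have h := lintegral_chordLength_sub_eq_excess e p ha hb hc (Real.sqrt_pos.2 h0)
    (Real.sq_sqrt h0.le).le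
  have hm := measurable_chordLength (isCompact_box e p a b c).measurableSet
  rw [excess_diagonal ha hb hc, ENNReal.ofReal_zero, lintegral_eq_zero_iff (by fun_prop)] at h
  refine measure_mono_null (fun l hl => ?_) h
  have hl : t < chordLength (box e p a b c) l := hl
  simp only [Set.mem_compl_iff, Set.mem_ofPred_eq, Pi.zero_apply, ENNReal.ofReal_eq_zero, not_le]
  linarith

open Filter Topology in
/-- The invariant measure of the lines meeting a box in a nondegenerate segment. -/
theorem lineMeasure_chordLength_pos (e : OrthonormalBasis (Fin 3) ℝ Space3) (p : Space3)
    {a b c : ℝ} (ha : 0 < a) (hb : 0 < b) (hc : 0 < c) :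
    lineMeasure {l | 0 < chordLength (box e p a b c) l}
      = ENNReal.ofReal (2 * Real.pi * (a * b + a * c + b * c)) := by
  have hD : 0 < √(a ^ 2 + b ^ 2 + c ^ 2) := Real.sqrt_pos.2 (by positivity)
  -- The tail formula needs a positive level, so level zero is reached by monotone approximation and
  -- continuity of `excess'`.
  have hun : {l | 0 < chordLength (box e p a b c) l}
      = ⋃ n : ℕ, {l | 1 / ((n : ℝ) + 1) < chordLength (box e p a b c) l} := by
    ext l
    simp only [Set.mem_ofPred_eq, Set.mem_iUnion]
    exact ⟨fun h => exists_nat_one_div_lt h,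
      fun ⟨n, hn⟩ => lt_trans (by positivity) hn⟩
  have hmono : Monotone fun n : ℕ => {l | 1 / ((n : ℝ) + 1) < chordLength (box e p a b c) l} := by
    intro m n hmn l hl
    have hl : 1 / ((m : ℝ) + 1) < chordLength (box e p a b c) l := hl
    exact (Nat.one_div_le_one_div hmn).trans_lt hl
  have h1 := tendsto_measure_iUnion_atTop (μ := lineMeasure) hmono
  rw [← hun] at h1
  have h2 : Tendsto (fun n : ℕ => ENNReal.ofReal (-excess' a b c (1 / ((n : ℝ) + 1)))) atTop
      (𝓝 (ENNReal.ofReal (-excess' a b c 0))) := by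
    refine ENNReal.tendsto_ofReal (Tendsto.neg ?_)
    exact ((continuous_excess' ha hb hc).tendsto 0).comp tendsto_one_div_add_atTop_nhds_zero_nat
  rw [excess'_zero ha hb hc, neg_neg] at h2
  refine tendsto_nhds_unique_of_eventuallyEq h1 h2 ?_
  filter_upwards [tendsto_one_div_add_atTop_nhds_zero_nat.eventually (gt_mem_nhds hD)] with n hn
  exact (lineMeasure_lt_chordLength e p ha hb hc (by positivity) hn).1

theorem tail_eq (e : OrthonormalBasis (Fin 3) ℝ Space3) (p : Space3)
    {a b c t : ℝ} (ha : 0 < a) (hb : 0 < b) (hc : 0 < c) (ht : 0 ≤ t)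
    (hD : t < √(a ^ 2 + b ^ 2 + c ^ 2)) :
    lineMeasure {l | t < chordLength (box e p a b c) l} = ENNReal.ofReal (-excess' a b c t) := by
  rcases ht.eq_or_lt with rfl | ht
  · rw [lineMeasure_chordLength_pos e p ha hb hc, excess'_zero ha hb hc, neg_neg]
  · exact (lineMeasure_lt_chordLength e p ha hb hc ht hD).1

/-! ### Lines that only touch the box -/

/-- A line meeting a box meets every enlarged box in a nondegenerate segment. -/
theorem linesMeeting_subset (e : OrthonormalBasis (Fin 3) ℝ Space3) (p : Space3) (a b c : ℝ)
    {ε : ℝ} (hε : 0 < ε) :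
    linesMeeting (box e p a b c) ⊆ {l | 0 < chordLength
      (box e (p - ε • ∑ i, e i) (a + 2 * ε) (b + 2 * ε) (c + 2 * ε)) l} := by
  rintro l ⟨s, hs⟩
  have hsub : Set.Icc (s - ε) (s + ε) ⊆
      {r | l.point r ∈ box e (p - ε • ∑ i, e i) (a + 2 * ε) (b + 2 * ε) (c + 2 * ε)} := by
    intro r hr i
    have h1 := hs i
    have h2 : inner ℝ (e i) (l.point r - (p - ε • ∑ i, e i))
        = inner ℝ (e i) (l.point s - p) + (r - s) * inner ℝ (e i) l.1.1 + ε := by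
      have : l.point r - (p - ε • ∑ i, e i)
          = (l.point s - p) + (r - s) • l.1.1 + ε • ∑ i, e i := by
        simp only [DirectedLine.point, sub_smul]
        abel
      have hsum : inner ℝ (e i) (∑ j, e j) = (1 : ℝ) := by
        rw [inner_sum]
        simp [e.inner_eq_ite]
      rw [this, inner_add_right, inner_add_right, inner_smul_right, inner_smul_right, hsum, mul_one]
    have h3 : |inner ℝ (e i) l.1.1| ≤ 1 := by
      have := abs_real_inner_le_norm (e i) l.1.1
      rwa [e.norm_eq_one, l.2.1, mul_one] at this
    have h4 : |(r - s) * inner ℝ (e i) l.1.1| ≤ ε := by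
      rw [abs_mul]
      have : |r - s| ≤ ε := abs_le.2 ⟨by linarith [hr.1], by linarith [hr.2]⟩
      nlinarith [abs_nonneg (r - s), abs_nonneg (inner ℝ (e i) l.1.1)]
    rw [h2]
    have h5 := abs_le.1 h4
    have h6 : ![a + 2 * ε, b + 2 * ε, c + 2 * ε] i = ![a, b, c] i + 2 * ε := by
      fin_cases i <;> rfl
    rw [h6]
    exact ⟨by linarith [h1.1], by linarith [h1.2]⟩
  have hfin := (isCompact_chord e (p - ε • ∑ i, e i) (a + 2 * ε) (b + 2 * ε) (c + 2 * ε)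
    l).measure_lt_top (μ := volume)
  refine ENNReal.toReal_pos (fun h0 => ?_) hfin.ne
  have := measure_mono_null hsub h0
  rw [Real.volume_Icc, ENNReal.ofReal_eq_zero] at this
  linarith

theorem chordLength_pos_subset (K : Set Space3) :
    {l | 0 < chordLength K l} ⊆ linesMeeting K := by
  intro l hl
  by_contra h
  have : {s : ℝ | l.point s ∈ K} = ∅ := by
    ext s
    simp only [Set.mem_ofPred_eq, Set.mem_empty_iff_false, iff_false]
    exact fun hs => h ⟨s, hs⟩
  have hl : 0 < chordLength K l := hl
  rw [chordLength, this] at hl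
  simp at hl

-- The lines meeting the box are contained in those with a nondegenerate chord in a box enlarged by
-- `ε`. The measure of the latter tends, as `ε → 0`, to that of the lines with a nondegenerate chord
-- in the box itself. Only an outer estimate of `linesMeeting` is used, so its measurability is not
-- needed beforehand.
open Filter Topology in
theorem linesMeeting_ae_eq (e : OrthonormalBasis (Fin 3) ℝ Space3) (p : Space3)
    {a b c : ℝ} (ha : 0 < a) (hb : 0 < b) (hc : 0 < c) :
    linesMeeting (box e p a b c) =ᵐ[lineMeasure] {l | 0 < chordLength (box e p a b c) l} := by
  have hsub := chordLength_pos_subset (box e p a b c)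
  have hm : MeasurableSet {l | 0 < chordLength (box e p a b c) l} :=
    measurableSet_lt measurable_const
      (measurable_chordLength (isCompact_box e p a b c).measurableSet)
  have h0 := lineMeasure_chordLength_pos e p ha hb hc
  have hle' : lineMeasure (linesMeeting (box e p a b c)) ≤
      ENNReal.ofReal (2 * Real.pi * (a * b + a * c + b * c)) := by
    have hle : ∀ᶠ ε : ℝ in 𝓝[>] 0, lineMeasure (linesMeeting (box e p a b c)) ≤
        ENNReal.ofReal (2 * Real.pi * ((a + 2 * ε) * (b + 2 * ε) + (a + 2 * ε) * (c + 2 * ε)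
          + (b + 2 * ε) * (c + 2 * ε))) := by
      filter_upwards [self_mem_nhdsWithin] with ε hε
      have hε : 0 < ε := hε
      rw [← lineMeasure_chordLength_pos e (p - ε • ∑ i, e i) (by linarith) (by linarith)
        (by linarith)]
      exact measure_mono (linesMeeting_subset e p a b c hε)
    have ht : Tendsto (fun ε : ℝ => ENNReal.ofReal (2 * Real.pi * ((a + 2 * ε) * (b + 2 * ε)
        + (a + 2 * ε) * (c + 2 * ε) + (b + 2 * ε) * (c + 2 * ε)))) (𝓝[>] 0)
        (𝓝 (ENNReal.ofReal (2 * Real.pi * (a * b + a * c + b * c)))) := by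
      have : Continuous fun ε : ℝ => ENNReal.ofReal (2 * Real.pi * ((a + 2 * ε) * (b + 2 * ε)
        + (a + 2 * ε) * (c + 2 * ε) + (b + 2 * ε) * (c + 2 * ε))) :=
        ENNReal.continuous_ofReal.comp (by fun_prop)
      have := this.tendsto 0
      simp only [mul_zero, add_zero] at this
      exact this.mono_left nhdsWithin_le_nhds
    exact ge_of_tendsto ht hle
  exact (ae_eq_of_subset_of_measure_ge hsub (h0 ▸ hle') hm.nullMeasurableSet
    (hle'.trans_lt ENNReal.ofReal_lt_top).ne).symm

/-! ### Identification of the density -/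

/-- Finite measures on the positive half-line are determined by their tails. -/
theorem measure_ext_of_Ioi_of_nonneg {μ ν : Measure ℝ} [IsFiniteMeasure μ] [IsFiniteMeasure ν]
    (hμ : μ (Set.Iic 0) = 0) (hν : ν (Set.Iic 0) = 0)
    (h : ∀ t, 0 ≤ t → μ (Set.Ioi t) = ν (Set.Ioi t)) : μ = ν := by
  have hneg : ∀ (ρ : Measure ℝ), ρ (Set.Iic 0) = 0 → ∀ t, ρ (Set.Ioi t) = ρ (Set.Ioi (max t 0)) := by
    intro ρ hρ t
    rcases le_total 0 t with h0 | h0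
    · rw [max_eq_left h0]
    · rw [max_eq_right h0]
      refine le_antisymm ?_ (measure_mono (Set.Ioi_subset_Ioi h0))
      calc ρ (Set.Ioi t) ≤ ρ (Set.Iic 0 ∪ Set.Ioi 0) := measure_mono fun x _ => le_or_gt x 0
        _ ≤ ρ (Set.Iic 0) + ρ (Set.Ioi 0) := measure_union_le _ _
        _ = ρ (Set.Ioi 0) := by rw [hρ, zero_add]
  have hall : ∀ t, μ (Set.Ioi t) = ν (Set.Ioi t) := fun t => by
    rw [hneg μ hμ, hneg ν hν, h _ (le_max_right _ _)]
  refine Measure.ext_of_Ioc μ ν fun x y hxy => ?_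
  rw [← Set.Ioi_sdiff_Ioi, measure_sdiff (Set.Ioi_subset_Ioi hxy.le) measurableSet_Ioi.nullMeasurableSet
    (measure_ne_top _ _), measure_sdiff (Set.Ioi_subset_Ioi hxy.le)
    measurableSet_Ioi.nullMeasurableSet (measure_ne_top _ _), hall, hall]

/-- No inspection of the formula is needed: `-excess'` is a tail, hence decreasing up to the
diagonal. -/
theorem excess''_nonneg {a b c t : ℝ} (ha : 0 < a) (hb : 0 < b) (hc : 0 < c) (ht : 0 < t)
    (hD : t < √(a ^ 2 + b ^ 2 + c ^ 2)) (h : t ∉ breakpoints a b c) : 0 ≤ excess'' a b c t := by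
  set e := EuclideanSpace.basisFun (Fin 3) ℝ
  have hmono : MonotoneOn (excess' a b c) (Set.Ioo 0 √(a ^ 2 + b ^ 2 + c ^ 2)) := by
    intro x hx y hy hxy
    obtain ⟨h1, h2⟩ := lineMeasure_lt_chordLength e 0 ha hb hc hx.1 hx.2
    obtain ⟨h3, h4⟩ := lineMeasure_lt_chordLength e 0 ha hb hc hy.1 hy.2
    have : lineMeasure {l | y < chordLength (box e 0 a b c) l}
        ≤ lineMeasure {l | x < chordLength (box e 0 a b c) l} :=
      measure_mono fun l (hl : y < _) => hxy.trans_lt hl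
    rw [h1, h3, ENNReal.ofReal_le_ofReal_iff h2] at this
    linarith
  have hnhds := Ioo_mem_nhds ht hD
  have hd := hasDerivAt_excess' ha hb hc h
  rw [← hd.deriv, ← derivWithin_of_mem_nhds hnhds]
  exact hmono.derivWithin_nonneg

/-- The density of the chord length of a box. -/
def chordDensity (a b c t : ℝ) : ℝ :=
  if 0 < t ∧ t < √(a ^ 2 + b ^ 2 + c ^ 2) then
    (boxF a b c t + boxF b c a t + boxF c a b t) /
      (3 * Real.pi * t ^ 3 * (a * b + a * c + b * c))
  else 0

theorem chordDensity_eq {a b c t : ℝ} (ha : 0 < a) (hb : 0 < b) (hc : 0 < c) (ht : 0 < t)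
    (hD : t < √(a ^ 2 + b ^ 2 + c ^ 2)) (h : t ∉ breakpoints a b c) :
    chordDensity a b c t = excess'' a b c t / (2 * Real.pi * (a * b + a * c + b * c)) := by
  rw [chordDensity, if_pos ⟨ht, hD⟩, excess''_eq_boxF ha hb hc ht h]
  have := Real.pi_pos
  field_simp

theorem ae_notMem_breakpoints (a b c : ℝ) : ∀ᵐ t : ℝ, t ∉ breakpoints a b c :=
  measure_eq_zero_iff_ae_notMem.1 ((countable_breakpoints a b c).measure_zero volume)

theorem chordDensity_nonneg_ae {a b c : ℝ} (ha : 0 < a) (hb : 0 < b) (hc : 0 < c) :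
    ∀ᵐ t : ℝ, 0 ≤ chordDensity a b c t := by
  filter_upwards [ae_notMem_breakpoints a b c] with t h
  by_cases hD : 0 < t ∧ t < √(a ^ 2 + b ^ 2 + c ^ 2)
  · rw [chordDensity_eq ha hb hc hD.1 hD.2 h]
    have := excess''_nonneg ha hb hc hD.1 hD.2 h
    have := Real.pi_pos
    positivity
  · rw [chordDensity, if_neg hD]

theorem measurable_boxF (a b c : ℝ) : Measurable (boxF a b c) := by
  unfold boxF
  refine Measurable.ite measurableSet_Iio (by fun_prop) ?_
  refine Measurable.ite measurableSet_Iio ?_ ?_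
  · simp only [← Real.norm_eq_abs]; fun_prop
  · simp only [← Real.norm_eq_abs]
    have := Real.measurable_arctan
    fun_prop

theorem measurable_chordDensity (a b c : ℝ) : Measurable (chordDensity a b c) := by
  unfold chordDensity
  have h1 := measurable_boxF a b c
  have h2 := measurable_boxF b c a
  have h3 := measurable_boxF c a b
  exact Measurable.ite measurableSet_Ioo (by fun_prop) measurable_const

/-- The tails of the candidate density. -/
theorem lintegral_chordDensity {a b c t : ℝ} (ha : 0 < a) (hb : 0 < b) (hc : 0 < c)
    (ht : 0 ≤ t) (hD : t ≤ √(a ^ 2 + b ^ 2 + c ^ 2)) :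
    ∫⁻ s in Set.Ioi t, ENNReal.ofReal (chordDensity a b c s)
      = ENNReal.ofReal (-excess' a b c t / (2 * Real.pi * (a * b + a * c + b * c))) := by
  set D := √(a ^ 2 + b ^ 2 + c ^ 2) with hDdef
  set S := 2 * Real.pi * (a * b + a * c + b * c) with hS
  have hSpos : 0 < S := by have := Real.pi_pos; positivity
  have h1 : ∫⁻ s in Set.Ioi t, ENNReal.ofReal (chordDensity a b c s)
      = ∫⁻ s in Set.Ioo t D, ENNReal.ofReal (excess'' a b c s / S) := by
    rw [← lintegral_indicator measurableSet_Ioi, ← lintegral_indicator measurableSet_Ioo]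
    refine lintegral_congr_ae ?_
    filter_upwards [ae_notMem_breakpoints a b c] with s hs
    by_cases h : s ∈ Set.Ioo t D
    · rw [Set.indicator_of_mem h, Set.indicator_of_mem (Set.mem_Ioi.2 h.1),
        chordDensity_eq ha hb hc (ht.trans_lt h.1) h.2 hs]
    · rw [Set.indicator_of_notMem h]
      by_cases h' : s ∈ Set.Ioi t
      · rw [Set.indicator_of_mem h', chordDensity, if_neg, ENNReal.ofReal_zero]
        exact fun hh => h ⟨h', hh.2⟩
      · rw [Set.indicator_of_notMem h']
  -- Integrating `excess'' / S` from `t` to the diagonal leaves only the boundary term at `t`,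
  -- because `excess'` vanishes at the diagonal.
  have hint := ((intervalIntegrable_excess'' ha hb hc hD).div_const S).1
  rw [h1, Measure.restrict_congr_set Ioo_ae_eq_Ioc, ← ofReal_integral_eq_lintegral_ofReal hint,
    ← intervalIntegral.integral_of_le hD, intervalIntegral.integral_div,
    integral_excess'' ha hb hc hD, excess'_diagonal ha hb hc, zero_sub]
  rw [← Measure.restrict_congr_set Ioo_ae_eq_Ioc]
  filter_upwards [ae_restrict_mem measurableSet_Ioo,
    ae_restrict_of_ae (ae_notMem_breakpoints a b c)] with s hs hs'
  have := excess''_nonneg ha hb hc (ht.trans_lt hs.1) hs.2 hs'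
  simp only [Pi.zero_apply]
  positivity

theorem randomLine_eq (e : OrthonormalBasis (Fin 3) ℝ Space3) (p : Space3)
    {a b c : ℝ} (ha : 0 < a) (hb : 0 < b) (hc : 0 < c) :
    randomLine (box e p a b c) = (ENNReal.ofReal (2 * Real.pi * (a * b + a * c + b * c)))⁻¹ •
      lineMeasure.restrict {l | 0 < chordLength (box e p a b c) l} := by
  have h := linesMeeting_ae_eq e p ha hb hc
  rw [randomLine, ProbabilityTheory.cond, Measure.restrict_congr_set h, measure_congr h,
    lineMeasure_chordLength_pos e p ha hb hc]

theorem isProbabilityMeasure_randomLine (e : OrthonormalBasis (Fin 3) ℝ Space3) (p : Space3)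
    {a b c : ℝ} (ha : 0 < a) (hb : 0 < b) (hc : 0 < c) :
    IsProbabilityMeasure (randomLine (box e p a b c)) := by
  have hSpos : 0 < 2 * Real.pi * (a * b + a * c + b * c) := by have := Real.pi_pos; positivity
  refine ⟨?_⟩
  rw [randomLine_eq e p ha hb hc, Measure.smul_apply, Measure.restrict_apply_univ,
    lineMeasure_chordLength_pos e p ha hb hc, smul_eq_mul]
  exact ENNReal.inv_mul_cancel (by simpa using hSpos) ENNReal.ofReal_ne_top

/-- Both measures ignore the nonpositive half-line, and for `t ≥ 0` their tails are `-excess' / S`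
below the diagonal, with `S` the total mass, and zero beyond it. -/
theorem map_chordLength_randomLine (e : OrthonormalBasis (Fin 3) ℝ Space3) (p : Space3)
    {a b c : ℝ} (ha : 0 < a) (hb : 0 < b) (hc : 0 < c) :
    (randomLine (box e p a b c)).map (chordLength (box e p a b c))
      = volume.withDensity fun t => ENNReal.ofReal (chordDensity a b c t) := by
  have hprob := isProbabilityMeasure_randomLine e p ha hb hc
  have hX := measurable_chordLength (isCompact_box e p a b c).measurableSet
  have hSpos : 0 < 2 * Real.pi * (a * b + a * c + b * c) := by have := Real.pi_pos; positivity
  have hmeas : ∀ t : ℝ, MeasurableSet {l | t < chordLength (box e p a b c) l} := fun t =>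
    measurableSet_lt measurable_const hX
  set ν := volume.withDensity fun t => ENNReal.ofReal (chordDensity a b c t) with hν
  have hneg : ν (Set.Iic 0) = 0 := by
    rw [hν, withDensity_apply _ measurableSet_Iic,
      setLIntegral_congr_fun (g := fun _ => 0) measurableSet_Iic, lintegral_zero]
    intro t ht
    have ht : t ≤ 0 := ht
    simp only [chordDensity, if_neg (fun h : 0 < t ∧ _ => not_lt.2 ht h.1), ENNReal.ofReal_zero]
  have htail : ∀ t, 0 ≤ t → ((randomLine (box e p a b c)).map (chordLength (box e p a b c)))
      (Set.Ioi t) = ν (Set.Ioi t) := by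
    intro t ht
    have hsub : {l | t < chordLength (box e p a b c) l} ⊆ {l | 0 < chordLength (box e p a b c) l} :=
      fun l (hl : t < _) => ht.trans_lt hl
    rw [Measure.map_apply hX measurableSet_Ioi, randomLine_eq e p ha hb hc, Measure.smul_apply,
      show chordLength (box e p a b c) ⁻¹' Set.Ioi t = {l | t < chordLength (box e p a b c) l} from rfl,
      Measure.restrict_apply (hmeas t), Set.inter_eq_left.2 hsub, hν,
      withDensity_apply _ measurableSet_Ioi, smul_eq_mul]
    rcases lt_or_ge t √(a ^ 2 + b ^ 2 + c ^ 2) with hD | hD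
    · rw [tail_eq e p ha hb hc ht hD, lintegral_chordDensity ha hb hc ht hD.le,
        ENNReal.ofReal_div_of_pos hSpos, ENNReal.div_eq_inv_mul]
    · rw [lineMeasure_diagonal_lt_chordLength e p ha hb hc hD, mul_zero,
        setLIntegral_congr_fun (g := fun _ => 0) measurableSet_Ioi, lintegral_zero]
      intro s hs
      have hs : t < s := hs
      simp only [chordDensity, if_neg (fun h : 0 < s ∧ _ => not_lt.2 (hD.trans hs.le) h.2),
        ENNReal.ofReal_zero]
  -- Finiteness is read off from the tail at zero, already known to agree with that of a probability
  -- measure.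
  have hfin : IsFiniteMeasure ν := by
    refine ⟨?_⟩
    have : (Set.univ : Set ℝ) = Set.Iic 0 ∪ Set.Ioi 0 := Set.Iic_union_Ioi.symm
    rw [this]
    refine (measure_union_le _ _).trans_lt ?_
    rw [hneg, zero_add, ← htail 0 le_rfl]
    have := Measure.isProbabilityMeasure_map (μ := randomLine (box e p a b c)) hX.aemeasurable
    exact measure_lt_top _ _
  have := Measure.isProbabilityMeasure_map (μ := randomLine (box e p a b c)) hX.aemeasurable
  refine measure_ext_of_Ioi_of_nonneg ?_ hneg htail
  rw [Measure.map_apply hX measurableSet_Iic, randomLine_eq e p ha hb hc, Measure.smul_apply,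
    Measure.restrict_apply (hX measurableSet_Iic)]
  have : chordLength (box e p a b c) ⁻¹' Set.Iic 0 ∩ {l | 0 < chordLength (box e p a b c) l} = ∅ := by
    ext l
    simp
  rw [this, measure_empty, smul_zero]

theorem theorem3 (a b c : ℝ) (ha : 0 < a) (hb : 0 < b) (hc : 0 < c)
    (e : OrthonormalBasis (Fin 3) ℝ Space3) (p : Space3) :
    IsProbabilityMeasure (randomLine (box e p a b c)) ∧
    HasPDF (chordLength (box e p a b c)) (randomLine (box e p a b c)) volume ∧
    ∀ᵐ t : ℝ,
      (pdf (chordLength (box e p a b c)) (randomLine (box e p a b c)) volume t).toReal =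
        if 0 < t ∧ t < √(a ^ 2 + b ^ 2 + c ^ 2) then
          (boxF a b c t + boxF b c a t + boxF c a b t) /
            (3 * Real.pi * t ^ 3 * (a * b + a * c + b * c))
        else 0 := by
  have hprob := isProbabilityMeasure_randomLine e p ha hb hc
  have hX := measurable_chordLength (isCompact_box e p a b c).measurableSet
  have hf : Measurable fun t => ENNReal.ofReal (chordDensity a b c t) :=
    (measurable_chordDensity a b c).ennreal_ofReal
  have hmap := map_chordLength_randomLine e p ha hb hc
  have hpdf : HasPDF (chordLength (box e p a b c)) (randomLine (box e p a b c)) volume :=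
    hasPDF_of_map_eq_withDensity hX.aemeasurable _ hf.aemeasurable hmap
  refine ⟨hprob, hpdf, ?_⟩
  -- Nonnegativity almost everywhere is what allows `ENNReal.ofReal` to be undone by `toReal`.
  filter_upwards [(pdf.eq_of_map_eq_withDensity _ hf.aemeasurable).1 hmap,
    chordDensity_nonneg_ae ha hb hc] with t h1 h2
  rw [h1, ENNReal.toReal_ofReal h2, chordDensity]

end
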